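/- **Theorem.** There are a randomized distributed algorithm $\mathcal A$ in the LOCAL model and a constant $C$ such that the following holds for every finite loopless directed graph $G=(V,E)$ whose underlying undirected graph is connected. Let $n=|V|$, $m=|E|$, and let $\Delta$ be the maximum degree of the underlying undirected graph. The communication network is the underlying undirected graph (communication is bidirectional); the vertices have distinct identifiers; initially each vertex knows only its own identifier, the identifiers of its out-neighbours and of its in-neighbours, and a common upper bound $N\ge n$ on the number of vertices. In every synchronous round each vertex exchanges messages of unbounded size with its neighbours, draws private independent uniform randomness from a finite set, and performs an arbitrary local computation. When a vertex halts, it outputs a set of directed edges incident to it. (a) *Guaranteed approximation.* For every outcome of the random draws, all vertices eventually halt, and the union $H\subseteq E$ of their outputs is a directed $2$-spanner of $G$ (that is, for every $(u,w)\in E$ the set $H$ contains a directed path of length at most $2$ from $u$ to $w$) with $$|H|\;\le\; C\cdot\max\{1,\log (m/n)\}\cdot |H^*|$$ for every directed $2$-spanner $H^*$ of $G$; i.e. the approximation ratio is $O(\log\frac mn)$. (b) *Round complexity.* For every $c\in\mathbb N$ there is a constant $C'$, depending only on $c$, such that, with probability at least $1-n^{-c}$, all vertices halt within $C'\cdot\max\{1,\log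 n\cdot\log\Delta\}$ rounds; i.e. the algorithm takes $O(\log n\log\Delta)$ rounds with high probability. -/

import Mathlib

open MeasureTheory

/-! ### Spanners of directed graphs -/

/-- `HasWalk S ℓ u w`: there is a directed walk with `ℓ` edges from `u` to `w`, all of whose
edges lie in the set `S` of directed edges. -/
inductive HasWalk {V : Type} (S : Set (V × V)) : ℕ → V → V → Prop
  | nil (u : V) : HasWalk S 0 u u
  | cons {ℓ : ℕ} {u v w : V} (huv : (u, v) ∈ S) (hvw : HasWalk S ℓ v w) : HasWalk S (ℓ + 1) u w

/-- The set of directed edges of a directed graph. -/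
def Digraph.edges {V : Type} (G : Digraph V) : Set (V × V) := {e | G.Adj e.1 e.2}

/-- `S` is a `k`-spanner of the directed graph `G`: it is a set of edges of `G`, and for every
edge `(u, w)` of `G` it contains a directed path of length at most `k` from `u` to `w`.
(A shortest walk is a path, so walks of length at most `k` may be used.) -/
def IsDirectedSpanner {V : Type} (G : Digraph V) (k : ℕ) (S : Set (V × V)) : Prop :=
  S ⊆ G.edges ∧ ∀ u w, G.Adj u w → ∃ ℓ ≤ k, HasWalk S ℓ u w

/-- `S` is a `k`-spanner of `G` whose size is at most `r` times the size of any `k`-spanner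
of `G`, in particular of a minimum one. -/
def IsApproxMinDirectedSpanner {V : Type} (G : Digraph V) (k : ℕ) (r : ℝ)
    (S : Set (V × V)) : Prop :=
  IsDirectedSpanner G k S ∧
    ∀ S' : Set (V × V), IsDirectedSpanner G k S' → (S.ncard : ℝ) ≤ r * (S'.ncard : ℝ)

/-! ### Networks -/

/-- A directed network: a loopless directed graph whose underlying undirected graph (the
communication graph) is connected, with pairwise distinct identifiers for the vertices. -/
structure Network (V : Type) where
  graph : Digraph V
  loopless : ∀ v, ¬ graph.Adj v v
  connected : graph.toSimpleGraphInclusive.Connected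
  ident : V → ℕ
  ident_injective : Function.Injective ident

namespace Network

variable {V : Type} [Fintype V] (Γ : Network V)

/-- The communication graph: communication is bidirectional along every directed edge. -/
def link : SimpleGraph V := Γ.graph.toSimpleGraphInclusive

/-- The number `n` of vertices. -/
def numVertices (_ : Network V) : ℕ := Fintype.card V

/-- The number `m` of directed edges. -/
noncomputable def numEdges : ℕ := Γ.graph.edges.ncard

/-- The maximum vertex degree `Δ` of the communication graph. -/
noncomputable def maxDegree : ℕ := Finset.univ.sup fun v => (Γ.link.neighborSet v).ncard

end Network

/-! ### Randomized algorithms in the LOCAL model -/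

/-- What a vertex knows before the first round: an upper bound on the number of vertices, its own
identifier, and the identifiers of its out-neighbours and of its in-neighbours. -/
structure LocalInput where
  bound : ℕ
  self : ℕ
  outNbrs : Set ℕ
  inNbrs : Set ℕ

/-- A randomized algorithm for a problem on directed graphs in the LOCAL model, in which every
vertex has to output a set of directed edges, given as pairs of identifiers.  Local
computation and message size are unrestricted. In every round each vertex
* sends to each neighbour a message, which depends on its state and on the neighbour's identifier;
* receives the messages of its neighbours, as a set of pairs (identifier of the sender, message);
* draws a fresh uniform element of `{0, …, sides N}`, where `N` is the known bound on the number
  of vertices;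
* computes its new state from these data.
A vertex halts as soon as its state carries an output. -/
structure LocalAlg where
  State : Type
  Msg : Type
  sides : ℕ → ℕ
  init : LocalInput → State
  send : State → ℕ → Msg
  step : State → ℕ → Set (ℕ × Msg) → State
  output : State → Option (Set (ℕ × ℕ))

namespace LocalAlg

variable (A : LocalAlg) {V : Type} (Γ : Network V) (N : ℕ)

/-- All the random draws of one execution: `ω (t, v)` is the draw of the vertex `v` in round `t`
(rounds are numbered from `0`). -/
abbrev Coins (V : Type) : Type := ℕ × V → Fin (A.sides N + 1)

/-- The law of the draws: they are independent and uniform. -/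
noncomputable def coinMeasure (V : Type) : Measure (A.Coins N V) :=
  Measure.infinitePi fun _ : ℕ × V => (PMF.uniformOfFintype (Fin (A.sides N + 1))).toMeasure

/-- The initial knowledge of the vertex `v`. -/
def localInput (v : V) : LocalInput where
  bound := N
  self := Γ.ident v
  outNbrs := {i | ∃ u, Γ.graph.Adj v u ∧ Γ.ident u = i}
  inNbrs := {i | ∃ u, Γ.graph.Adj u v ∧ Γ.ident u = i}

/-- The messages that arrive at the vertex `v` when the vertices are in the states `σ`. -/
def inbox (σ : V → A.State) (v : V) : Set (ℕ × A.Msg) :=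
  {p | ∃ u, Γ.link.Adj v u ∧ p = (Γ.ident u, A.send (σ u) (Γ.ident v))}

/-- The states of all vertices after `t` rounds. The state of a halted vertex never changes. -/
def run (ω : A.Coins N V) : ℕ → V → A.State
  | 0 => fun v => A.init (localInput Γ N v)
  | t + 1 => fun v =>
      if (A.output (run ω t v)).isSome then run ω t v
      else A.step (run ω t v) (ω (t, v)) (A.inbox Γ (run ω t) v)

/-- All vertices have halted within `t` rounds. -/
def HaltsWithin (ω : A.Coins N V) (t : ℕ) : Prop :=
  ∀ v, (A.output (A.run Γ N ω t v)).isSome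

/-- After `t` rounds, every output that has been made consists of edges incident to the vertex
that makes it. -/
def OutputsIncidentEdges (ω : A.Coins N V) (t : ℕ) : Prop :=
  ∀ v F, A.output (A.run Γ N ω t v) = some F →
    ∀ p ∈ F, ∃ e ∈ Γ.graph.edges, (e.1 = v ∨ e.2 = v) ∧ p = (Γ.ident e.1, Γ.ident e.2)

/-- The union of the outputs made within `t` rounds, as a set of pairs of vertices. -/
def outputEdges (ω : A.Coins N V) (t : ℕ) : Set (V × V) :=
  {e | ∃ v F, A.output (A.run Γ N ω t v) = some F ∧ (Γ.ident e.1, Γ.ident e.2) ∈ F}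

end LocalAlg

/-!
# Approximate minimum 2-spanners in the LOCAL model

**The covering process.** A star at a vertex `c` is a set of edges between `c` and its neighbours;
it `2`-spans the edges `(a, b)` for which it contains `(a, c)` and `(c, b)`. The uncovered edges
that can be `2`-spanned by a star at `c` form a bipartite graph `spanPairs` between the
in-neighbours and the out-neighbours of `c`, stars are sets of vertices of this graph, and the
density of a star is the quotient of the numbers of edges and vertices of the induced subgraph. Up
to constant factors, the highest density is found by a variant of the `k`-core: `core l P` is the
largest subgraph of `P` in which all degrees are at least `2 ^ l / 2`. It has density at least
`2 ^ l / 4` (`IsDense.card_image_le`), if it is empty then all densities are at most `2 ^ l / 2`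
(`two_mul_card_le_of_core_eq_empty`), and it only shrinks when edges are removed (`core_mono`). In
every phase, the vertices whose density level is maximal within distance two are candidates and
propose their highest nonempty core; every uncovered edge votes for the candidate of smallest
random rank among those that `2`-span it, and the stars which obtain an eighth of the possible
votes are accepted. At the end, the edges which cannot be `2`-spanned are added.

**The approximation ratio.** An accepted star of level `l` is paid for by its voters, with
`32 / 2 ^ l` each (`sum_card_legs_le`). In a spanner `H`, an edge that is not in `H` is
`2`-spanned by the star of all edges of `H` at some vertex `x`; let `s` be the size of this star.
As candidates are locally densest, at most `2 ^ l * s` of the edges that it `2`-spans are covered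
at level `l` or below (`card_filter_coverLevel_le`). Hence each level costs `O(s)`, which makes
`O(J * |H|)` for the first `J` levels and all stars, while the edges covered above the level `J`
cost `32 * m / 2 ^ J` altogether (`card_spanner_le`). With `2 ^ J ≈ m / n` the latter is `O(n)`,
thus `O(|H|)`, because `H` is connected.

**The number of rounds.** Let `L` be the highest level of all vertices. All vertices of level `L`
are candidates, and they compete only with each other. If `s e` of them `2`-span the edge `e`, and
if `e` votes for `c`, then another edge `f` of the star of `c` does the same with conditional
probability at least about `s e / (s e + s f)`, which is a half on average over `e` and `f`. So an
edge is likely to vote for an accepted star, and the total size of the cores of level `L`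
decreases by a constant factor in expectation (`le_sum_sum_votesFor`, `sum_coreSize_residual_le`).
The potential `∑ l, B ^ l * coreSize l`, where `B` is polynomial in `n`, is dominated by its term
for the highest level, hence it decreases in the same way (`sum_potential_residual_le`), through
all levels. As there are `O(log Δ)` levels, it is at most `n ^ O(log Δ)` initially, and Markov's
inequality gives the bound `O(log n * log Δ)` on the number of phases, with high probability. In
any case, a phase covers an edge if one can be `2`-spanned (`residual_ssubset`).

**The simulation.** A phase takes six rounds. A vertex halts when all levels within distance two
are zero. Nothing that it would have to report ever changes afterwards (`Halted.succ`), so that it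
does not matter that its memory is frozen.
-/

namespace TwoSpanner

/-! ### Dense cores of bipartite graphs -/

section Core

variable {α β : Type*} [DecidableEq α] [DecidableEq β]

/-- A finite bipartite graph, given by its set of edges, in which every vertex that is not isolated
has degree at least `2 ^ l / 2`. -/
def IsDense (l : ℕ) (Q : Finset (α × β)) : Prop :=
  ∀ e ∈ Q, 2 ^ l ≤ 2 * (Q.filter fun f => f.1 = e.1).card ∧
    2 ^ l ≤ 2 * (Q.filter fun f => f.2 = e.2).card

open Classical in
/-- The core of density level `l` of a bipartite graph: the union of all its dense subgraphs, which
is the largest dense subgraph. -/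
noncomputable def core (l : ℕ) (P : Finset (α × β)) : Finset (α × β) :=
  P.filter fun e => ∃ Q ⊆ P, IsDense l Q ∧ e ∈ Q

theorem core_subset (l : ℕ) (P : Finset (α × β)) : core l P ⊆ P := by
  classical exact Finset.filter_subset _ _

theorem IsDense.subset_core {l : ℕ} {P Q : Finset (α × β)} (hQ : IsDense l Q) (h : Q ⊆ P) :
    Q ⊆ core l P := fun e he => by
  simp only [core, Finset.mem_filter]
  exact ⟨h he, Q, h, hQ, he⟩

theorem isDense_core (l : ℕ) (P : Finset (α × β)) : IsDense l (core l P) := by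
  intro e he
  obtain ⟨-, Q, hQP, hQ, heQ⟩ := by simpa only [core, Finset.mem_filter] using he
  have hsub := hQ.subset_core hQP
  obtain ⟨h1, h2⟩ := hQ e heQ
  exact ⟨h1.trans (by gcongr), h2.trans (by gcongr)⟩

theorem core_mono (l : ℕ) {P P' : Finset (α × β)} (h : P ⊆ P') : core l P ⊆ core l P' :=
  (isDense_core l P).subset_core ((core_subset l P).trans h)

theorem IsDense.card_image_le {l : ℕ} {Q : Finset (α × β)} (hQ : IsDense l Q) :
    2 ^ l * ((Q.image Prod.fst).card + (Q.image Prod.snd).card) ≤ 4 * Q.card := by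
  have h1 : 2 ^ l * (Q.image Prod.fst).card ≤ 2 * Q.card := by
    rw [Finset.card_eq_sum_card_image Prod.fst Q, Finset.mul_sum, mul_comm, ← smul_eq_mul]
    refine Finset.card_nsmul_le_sum _ _ _ fun a ha => ?_
    obtain ⟨e, he, rfl⟩ := Finset.mem_image.1 ha
    exact (hQ e he).1
  have h2 : 2 ^ l * (Q.image Prod.snd).card ≤ 2 * Q.card := by
    rw [Finset.card_eq_sum_card_image Prod.snd Q, Finset.mul_sum, mul_comm, ← smul_eq_mul]
    refine Finset.card_nsmul_le_sum _ _ _ fun a ha => ?_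
    obtain ⟨e, he, rfl⟩ := Finset.mem_image.1 ha
    exact (hQ e he).2
  linarith

/-- A graph without a dense core is sparse: a vertex of low degree can be removed again and again
until no edge is left. -/
theorem two_mul_card_le_of_core_eq_empty {l : ℕ} {P : Finset (α × β)} (h : core l P = ∅)
    {A : Finset α} {B : Finset β} (hP : P ⊆ A ×ˢ B) :
    2 * P.card ≤ 2 ^ l * (A.card + B.card) := by
  induction hk : A.card + B.card generalizing A B P with
  | zero =>
    have hA : A = ∅ := Finset.card_eq_zero.1 (by omega)
    subst hA
    simp [Finset.subset_empty.1 (hP.trans (by simp))]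
  | succ k ih =>
    by_cases hd : IsDense l P
    · have : P = ∅ := Finset.subset_empty.1 (h ▸ hd.subset_core subset_rfl)
      simp [this]
    · simp only [IsDense, not_forall] at hd
      obtain ⟨e, he, hlow⟩ := hd
      have heAB := Finset.mem_product.1 (hP he)
      rw [not_and_or, not_le, not_le] at hlow
      have key : ∀ p : α × β → Prop, [DecidablePred p] →
          2 * (P.filter p).card < 2 ^ l → 2 * (P.filter fun f => ¬ p f).card ≤ 2 ^ l * k →
          2 * P.card ≤ 2 ^ l * (k + 1) := fun p _ h1 h2 => by
        have := Finset.card_filter_add_card_filter_not (s := P) p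
        rw [mul_add]; omega
      have hempty : ∀ p : α × β → Prop, [DecidablePred p] → core l (P.filter p) = ∅ :=
        fun p _ => Finset.subset_empty.1 (h ▸ core_mono l (Finset.filter_subset _ _))
      rcases hlow with hlow | hlow
      · refine key _ hlow (ih (A := A.erase e.1) (B := B) (hempty _) (fun f hf => ?_) ?_)
        · have := Finset.mem_filter.1 hf
          have h2 := Finset.mem_product.1 (hP this.1)
          simp [this.2, h2.1, h2.2]
        · have := Finset.card_erase_add_one heAB.1
          omega
      · refine key _ hlow (ih (A := A) (B := B.erase e.2) (hempty _) (fun f hf => ?_) ?_)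
        · have := Finset.mem_filter.1 hf
          have h2 := Finset.mem_product.1 (hP this.1)
          simp [this.2, h2.1, h2.2]
        · have := Finset.card_erase_add_one heAB.2
          omega

theorem core_one (P : Finset (α × β)) : core 1 P = P := by
  refine (core_subset 1 P).antisymm (IsDense.subset_core (fun e he => ?_) subset_rfl)
  constructor
  · have : 0 < (P.filter fun f => f.1 = e.1).card :=
      Finset.card_pos.2 ⟨e, by simp [he]⟩
    omega
  · have : 0 < (P.filter fun f => f.2 = e.2).card :=
      Finset.card_pos.2 ⟨e, by simp [he]⟩
    omega

theorem le_card_of_core_nonempty {l : ℕ} {P : Finset (α × β)} (h : (core l P).Nonempty) :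
    l ≤ P.card := by
  obtain ⟨e, he⟩ := h
  have h1 := (isDense_core l P e he).1
  have h2 : ((core l P).filter fun f => f.1 = e.1).card ≤ P.card :=
    Finset.card_le_card ((Finset.filter_subset _ _).trans (core_subset l P))
  rcases l with _ | l
  · exact Nat.zero_le _
  · have := Nat.lt_two_pow_self (n := l)
    rw [pow_succ] at h1
    omega

open Classical in
/-- The density level of a bipartite graph: the largest `l` such that the core of level `l` is not
empty. It is `0` only for the graph without edges. -/
noncomputable def level (P : Finset (α × β)) : ℕ :=
  Nat.findGreatest (fun l => (core l P).Nonempty) P.card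

/-- The core of the highest possible level. -/
noncomputable def topCore (P : Finset (α × β)) : Finset (α × β) := core (level P) P

theorem le_level {l : ℕ} {P : Finset (α × β)} (h : (core l P).Nonempty) : l ≤ level P :=
  Nat.le_findGreatest (le_card_of_core_nonempty h) h

theorem core_eq_empty_of_level_lt {l : ℕ} {P : Finset (α × β)} (h : level P < l) :
    core l P = ∅ := by
  by_contra hne
  exact absurd (le_level (Finset.nonempty_iff_ne_empty.2 hne)) (by omega)

theorem level_pos {P : Finset (α × β)} : 0 < level P ↔ P.Nonempty := by
  constructor
  · intro h
    by_contra hP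
    rw [Finset.not_nonempty_iff_eq_empty] at hP
    subst hP
    simp [level] at h
  · intro h
    exact le_level (l := 1) (by rwa [core_one])

theorem topCore_nonempty {P : Finset (α × β)} (h : P.Nonempty) : (topCore P).Nonempty := by
  have h1 : (core 1 P).Nonempty := by rwa [core_one]
  exact Nat.findGreatest_spec (P := fun l => (core l P).Nonempty) (le_card_of_core_nonempty h1) h1

end Core

/-! ### One phase of the covering process -/

section Phase

variable (E U : Finset (ℕ × ℕ)) (r : ℕ → ℕ)

/-- Adjacency in the communication graph of the directed graph with the set `E` of edges. -/
def Nbr (c d : ℕ) : Prop := (c, d) ∈ E ∨ (d, c) ∈ E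

/-- The uncovered edges which are `2`-spanned by paths through `c`, as a bipartite graph between
the in-neighbours and the out-neighbours of `c`. A star at `c` is a set of vertices of this graph,
and it `2`-spans the edges of the induced subgraph. -/
def spanPairs (c : ℕ) : Finset (ℕ × ℕ) := U.filter fun e => (e.1, c) ∈ E ∧ (c, e.2) ∈ E

/-- The density level of the vertex `c`. -/
noncomputable def lv (c : ℕ) : ℕ := level (spanPairs E U c)

/-- The set of edges which are `2`-spanned by the star proposed by `c`. The star itself consists of
the edges `legs c (star E U c)`. -/
noncomputable def star (c : ℕ) : Finset (ℕ × ℕ) := topCore (spanPairs E U c)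

/-- The edges of the star with centre `c` which are needed to `2`-span `Q`. -/
def legs (c : ℕ) (Q : Finset (ℕ × ℕ)) : Finset (ℕ × ℕ) :=
  (Q.image Prod.fst).image (fun a => (a, c)) ∪ (Q.image Prod.snd).image (fun b => (c, b))

/-- The density levels of the vertices at distance at most `k` from `c`. -/
def seen : ℕ → ℕ → Set ℕ
  | 0, c => {lv E U c}
  | k + 1, c => seen k c ∪ {l | ∃ d, Nbr E c d ∧ l ∈ seen k d}

/-- A vertex is a candidate if its density level is positive and maximal among the vertices at
distance at most two. -/
def IsCand (c : ℕ) : Prop := 0 < lv E U c ∧ ∀ l ∈ seen E U 2 c, l ≤ lv E U c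

/-- The edge `e` votes for the first candidate, in the order of the ranks `r` (with ties broken by
identifiers), whose star `2`-spans it. -/
def Votes (e : ℕ × ℕ) (c : ℕ) : Prop :=
  IsCand E U c ∧ e ∈ star E U c ∧
    ∀ c', IsCand E U c' → e ∈ star E U c' → r c < r c' ∨ (r c = r c' ∧ c ≤ c')

open Classical in
/-- A candidate is accepted if at least an eighth of the edges `2`-spanned by its star vote for
it. -/
def Accepted (c : ℕ) : Prop :=
  IsCand E U c ∧ (star E U c).card ≤ 8 * ((star E U c).filter fun e => Votes E U r e c).card

open Classical in
/-- The edges which are still uncovered after the phase. Only the edges `2`-spanned by an accepted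
star count as covered, not the edges of the star itself. -/
noncomputable def residual : Finset (ℕ × ℕ) :=
  U.filter fun e => ¬ ∃ c, Accepted E U r c ∧ e ∈ star E U c

/-- The vertices of the directed graph with the set `E` of edges which are not isolated. -/
def verts : Finset ℕ := E.image Prod.fst ∪ E.image Prod.snd

variable {E U r}

theorem mem_spanPairs {e : ℕ × ℕ} {c : ℕ} :
    e ∈ spanPairs E U c ↔ e ∈ U ∧ (e.1, c) ∈ E ∧ (c, e.2) ∈ E := by simp [spanPairs]

theorem spanPairs_mono {U' : Finset (ℕ × ℕ)} (h : U' ⊆ U) (c : ℕ) :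
    spanPairs E U' c ⊆ spanPairs E U c := Finset.filter_subset_filter _ h

theorem star_subset (c : ℕ) : star E U c ⊆ spanPairs E U c := core_subset _ _

theorem mem_of_mem_star {e : ℕ × ℕ} {c : ℕ} (h : e ∈ star E U c) :
    e ∈ U ∧ (e.1, c) ∈ E ∧ (c, e.2) ∈ E := mem_spanPairs.1 (star_subset c h)

theorem lv_pos {c : ℕ} : 0 < lv E U c ↔ (spanPairs E U c).Nonempty := level_pos

theorem star_nonempty {c : ℕ} (h : 0 < lv E U c) : (star E U c).Nonempty :=
  topCore_nonempty (lv_pos.1 h)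

theorem mem_verts_of_lv_pos {c : ℕ} (h : 0 < lv E U c) : c ∈ verts E := by
  obtain ⟨e, he⟩ := lv_pos.1 h
  exact Finset.mem_union_right _ (Finset.mem_image.2 ⟨_, (mem_spanPairs.1 he).2.1, rfl⟩)

theorem star_eq_empty_of_lv_eq_zero {c : ℕ} (h : lv E U c = 0) : star E U c = ∅ := by
  have h1 : spanPairs E U c = ∅ := by
    by_contra hne
    exact absurd (lv_pos.2 (Finset.nonempty_iff_ne_empty.2 hne)) (by omega)
  exact Finset.subset_empty.1 (h1 ▸ star_subset c)

theorem lv_mem_seen_two {c d a : ℕ} (h1 : Nbr E c a) (h2 : Nbr E a d) :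
    lv E U d ∈ seen E U 2 c :=
  Or.inr ⟨a, h1, Or.inr ⟨d, h2, rfl⟩⟩

/-- The edges `2`-spanned by the star of a candidate are not `2`-spanned by paths through any
vertex of a higher level. -/
theorem IsCand.lv_le {c d : ℕ} (hc : IsCand E U c) {e : ℕ × ℕ} (he : e ∈ star E U c)
    (h : (e.1, d) ∈ E) : lv E U d ≤ lv E U c :=
  hc.2 _ (lv_mem_seen_two (Or.inr (mem_of_mem_star he).2.1) (Or.inl h))

theorem IsCand.lv_eq {c c' : ℕ} (hc : IsCand E U c) (hc' : IsCand E U c') {e : ℕ × ℕ}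
    (he : e ∈ star E U c) (he' : e ∈ star E U c') : lv E U c = lv E U c' :=
  (hc'.lv_le he' (mem_of_mem_star he).2.1).antisymm (hc.lv_le he (mem_of_mem_star he').2.1)

theorem exists_lv_of_mem_seen {k c l : ℕ} (h : l ∈ seen E U k c) : ∃ d, l = lv E U d := by
  induction k generalizing c with
  | zero => exact ⟨c, h⟩
  | succ k ih =>
    rcases h with h | ⟨d, -, h⟩
    · exact ih h
    · exact ih h

theorem isCand_of_forall_lv_le {c : ℕ} (h0 : 0 < lv E U c) (h : ∀ d, lv E U d ≤ lv E U c) :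
    IsCand E U c :=
  ⟨h0, fun l hl => by obtain ⟨d, rfl⟩ := exists_lv_of_mem_seen hl; exact h d⟩

theorem exists_forall_lv_le (h : ∃ c, 0 < lv E U c) :
    ∃ c, 0 < lv E U c ∧ ∀ d, lv E U d ≤ lv E U c := by
  obtain ⟨c₀, h₀⟩ := h
  obtain ⟨c, hc, hmax⟩ := (verts E).exists_max_image (lv E U) ⟨c₀, mem_verts_of_lv_pos h₀⟩
  refine ⟨c, h₀.trans_le (hmax _ (mem_verts_of_lv_pos h₀)), fun d => ?_⟩
  by_cases hd : 0 < lv E U d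
  · exact hmax _ (mem_verts_of_lv_pos hd)
  · omega

theorem Votes.unique {e : ℕ × ℕ} {c c' : ℕ} (h : Votes E U r e c) (h' : Votes E U r e c') :
    c = c' := by
  have h1 := h.2.2 c' h'.1 h'.2.1
  have h2 := h'.2.2 c h.1 h.2.1
  omega

theorem residual_subset : residual E U r ⊆ U := by
  classical exact Finset.filter_subset _ _

theorem mem_residual {e : ℕ × ℕ} :
    e ∈ residual E U r ↔ e ∈ U ∧ ¬ ∃ c, Accepted E U r c ∧ e ∈ star E U c := by
  simp only [residual, Finset.mem_filter]

/-- The very first candidate gets all the votes it can get, so that every phase covers an edge as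
long as this is possible. -/
theorem residual_ssubset (h : ∃ c, 0 < lv E U c) : residual E U r ⊂ U := by
  classical
  obtain ⟨c₀, h₀, hmax⟩ := exists_forall_lv_le h
  have hc₀ := isCand_of_forall_lv_le h₀ hmax
  obtain ⟨c, hc, hmin⟩ := ((verts E).filter (IsCand E U)).exists_min_image
    (fun c => toLex (r c, c)) ⟨c₀, Finset.mem_filter.2 ⟨mem_verts_of_lv_pos h₀, hc₀⟩⟩
  replace hc := (Finset.mem_filter.1 hc).2
  have hv : ∀ e ∈ star E U c, Votes E U r e c := fun e he => ⟨hc, he, fun c' hc' _ => by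
    have := hmin c' (Finset.mem_filter.2 ⟨mem_verts_of_lv_pos hc'.1, hc'⟩)
    simpa [Prod.Lex.le_iff] using this⟩
  have hacc : Accepted E U r c := ⟨hc, by rw [Finset.filter_true_of_mem hv]; omega⟩
  obtain ⟨e, he⟩ := star_nonempty hc.1
  refine Finset.ssubset_iff_subset_ne.2 ⟨residual_subset, fun heq => ?_⟩
  have : e ∈ residual E U r := by rw [heq]; exact (mem_of_mem_star he).1
  exact (mem_residual.1 this).2 ⟨c, hacc, he⟩

theorem card_legs_le {c : ℕ} {Q : Finset (ℕ × ℕ)} :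
    (legs c Q).card ≤ (Q.image Prod.fst).card + (Q.image Prod.snd).card :=
  (Finset.card_union_le _ _).trans (add_le_add Finset.card_image_le Finset.card_image_le)

theorem mem_legs {c : ℕ} {Q : Finset (ℕ × ℕ)} {p : ℕ × ℕ} :
    p ∈ legs c Q ↔ ∃ e ∈ Q, p = (e.1, c) ∨ p = (c, e.2) := by
  simp only [legs, Finset.mem_union, Finset.mem_image]
  constructor
  · rintro (⟨a, ⟨e, he, rfl⟩, rfl⟩ | ⟨a, ⟨e, he, rfl⟩, rfl⟩)
    · exact ⟨e, he, Or.inl rfl⟩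
    · exact ⟨e, he, Or.inr rfl⟩
  · rintro ⟨e, he, rfl | rfl⟩
    · exact Or.inl ⟨_, ⟨e, he, rfl⟩, rfl⟩
    · exact Or.inr ⟨_, ⟨e, he, rfl⟩, rfl⟩

open Classical in
variable (E U) in
/-- The common level of the candidates whose stars `2`-span the edge `e`. -/
noncomputable def edgeLevel (e : ℕ × ℕ) : ℕ :=
  if h : ∃ c, IsCand E U c ∧ e ∈ star E U c then lv E U h.choose else 0

theorem IsCand.edgeLevel_eq {c : ℕ} (hc : IsCand E U c) {e : ℕ × ℕ} (he : e ∈ star E U c) :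
    edgeLevel E U e = lv E U c := by
  have h : ∃ c, IsCand E U c ∧ e ∈ star E U c := ⟨c, hc, he⟩
  rw [edgeLevel, dif_pos h]
  exact h.choose_spec.1.lv_eq hc h.choose_spec.2 he

theorem exists_isCand_of_mem_sdiff_residual {e : ℕ × ℕ} (h : e ∈ U \ residual E U r) :
    ∃ c, IsCand E U c ∧ e ∈ star E U c := by
  rw [Finset.mem_sdiff, mem_residual, not_and, not_not] at h
  obtain ⟨c, hc, he⟩ := h.2 h.1
  exact ⟨c, hc.1, he⟩

open Classical in
/-- The edges of the accepted stars are paid for by the edges covered in the phase: an edge of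
level `l` pays `32 / 2 ^ l`, to the candidate it votes for. -/
theorem sum_card_legs_le :
    ∑ c ∈ (verts E).filter (Accepted E U r), ((legs c (star E U c)).card : ℝ) ≤
      ∑ e ∈ U \ residual E U r, 32 / 2 ^ edgeLevel E U e := by
  have h1 : ∀ c ∈ (verts E).filter (Accepted E U r), ((legs c (star E U c)).card : ℝ) ≤
      ∑ e ∈ (star E U c).filter fun e => Votes E U r e c, (32 : ℝ) / 2 ^ edgeLevel E U e := by
    intro c hc
    -- `4 * |star| / 2 ^ l` legs, and at least an eighth of the edges of `star` as voters
    obtain ⟨-, hcand, hacc⟩ := Finset.mem_filter.1 hc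
    have h2 : ∀ e ∈ (star E U c).filter fun e => Votes E U r e c,
        (32 : ℝ) / 2 ^ edgeLevel E U e = 32 / 2 ^ lv E U c := fun e he => by
      rw [hcand.edgeLevel_eq (Finset.mem_filter.1 he).1]
    rw [Finset.sum_congr rfl h2, Finset.sum_const, nsmul_eq_mul, ← mul_div_assoc,
      le_div_iff₀ (by positivity)]
    have h3 := (isDense_core (lv E U c) (spanPairs E U c)).card_image_le
    change 2 ^ lv E U c * (((star E U c).image _).card + ((star E U c).image _).card)
      ≤ 4 * (star E U c).card at h3
    have h4 : (legs c (star E U c)).card * 2 ^ lv E U c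
        ≤ ((star E U c).filter fun e => Votes E U r e c).card * 32 := by
      have := Nat.mul_le_mul_left (2 ^ lv E U c) (card_legs_le (c := c) (Q := star E U c))
      linarith
    exact_mod_cast h4
  refine (Finset.sum_le_sum h1).trans ?_
  rw [← Finset.sum_biUnion]
  · refine Finset.sum_le_sum_of_subset_of_nonneg (fun e he => ?_) fun _ _ _ => by positivity
    obtain ⟨c, hc, he⟩ := Finset.mem_biUnion.1 he
    have he := (Finset.mem_filter.1 he).1
    rw [Finset.mem_sdiff, mem_residual, not_and, not_not]
    exact ⟨(mem_of_mem_star he).1, fun _ => ⟨c, (Finset.mem_filter.1 hc).2, he⟩⟩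
  · intro c _ c' _ hne
    refine Finset.disjoint_left.2 fun e he he' => hne ?_
    exact (Finset.mem_filter.1 he).2.unique (Finset.mem_filter.1 he').2

/-- If a star at `x` with the in-legs `A` and the out-legs `B` `2`-spans an edge that is covered by
a candidate of level at most `l`, then it `2`-spans few uncovered edges. -/
theorem card_le_of_edgeLevel_le {e : ℕ × ℕ} (he : e ∈ U \ residual E U r) {l x : ℕ}
    (hl : edgeLevel E U e ≤ l) {A B : Finset ℕ} (hA : ∀ a ∈ A, (a, x) ∈ E)
    (hB : ∀ b ∈ B, (x, b) ∈ E) (heA : e.1 ∈ A) :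
    (U ∩ A ×ˢ B).card ≤ 2 ^ l * (A.card + B.card) := by
  obtain ⟨c, hc, hec⟩ := exists_isCand_of_mem_sdiff_residual he
  rw [hc.edgeLevel_eq hec] at hl
  have h1 : lv E U x < l + 1 := by have := hc.lv_le hec (hA _ heA); omega
  have h2 : U ∩ A ×ˢ B ⊆ spanPairs E U x := fun f hf => by
    obtain ⟨hfU, hf⟩ := Finset.mem_inter.1 hf
    obtain ⟨hf1, hf2⟩ := Finset.mem_product.1 hf
    exact mem_spanPairs.2 ⟨hfU, hA _ hf1, hB _ hf2⟩
  have h3 : core (l + 1) (U ∩ A ×ˢ B) = ∅ :=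
    Finset.subset_empty.1 (core_eq_empty_of_level_lt h1 ▸ core_mono _ h2)
  have h4 := two_mul_card_le_of_core_eq_empty h3 Finset.inter_subset_right
  rw [pow_succ] at h4
  linarith

end Phase

/-! ### The covering process and its cost -/

section Covering

variable (E : Finset (ℕ × ℕ)) (r : ℕ → ℕ → ℕ)

/-- The uncovered edges after `i` phases, if the ranks `r i` are used in the phase `i`. -/
noncomputable def uncovered : ℕ → Finset (ℕ × ℕ)
  | 0 => E
  | i + 1 => residual E (uncovered i) (r i)

open Classical in
/-- The edges of the accepted stars with centre `c` after `i` phases. -/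
noncomputable def selected : ℕ → ℕ → Finset (ℕ × ℕ)
  | 0, _ => ∅
  | i + 1, c => selected i c ∪
      if Accepted E (uncovered E r i) (r i) c then legs c (star E (uncovered E r i) c) else ∅

/-- The edges of all accepted stars and all edges left uncovered, after `T` phases. -/
noncomputable def spanner (T : ℕ) : Finset (ℕ × ℕ) :=
  (verts E).biUnion (selected E r T) ∪ uncovered E r T

/-- The level at which an edge was covered during the first `i` phases. The value is irrelevant for
an edge that is still uncovered. -/
noncomputable def coverLevel : ℕ → ℕ × ℕ → ℕ
  | 0, _ => 0
  | i + 1, e =>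
      if e ∈ uncovered E r i then edgeLevel E (uncovered E r i) e else coverLevel i e

variable {E r}

theorem uncovered_succ_subset (i : ℕ) : uncovered E r (i + 1) ⊆ uncovered E r i :=
  residual_subset

theorem uncovered_subset (i : ℕ) : uncovered E r i ⊆ E := by
  induction i with
  | zero => exact subset_rfl
  | succ i ih => exact (uncovered_succ_subset i).trans ih

theorem exists_forall_lv_eq_zero : ∃ T, ∀ c, lv E (uncovered E r T) c = 0 := by
  by_contra! h
  have hcard : ∀ i, (uncovered E r i).card + i ≤ E.card := by
    intro i
    induction i with
    | zero => exact le_rfl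
    | succ i ih =>
      obtain ⟨c, hc⟩ := h i
      have := Finset.card_lt_card
        (residual_ssubset (r := r i) ⟨c, Nat.pos_of_ne_zero hc⟩)
      simp only [uncovered]
      omega
  have := hcard (E.card + 1)
  omega

theorem selected_subset (i c : ℕ) : ∀ p ∈ selected E r i c, p ∈ E ∧ (p.1 = c ∨ p.2 = c) := by
  induction i with
  | zero => simp [selected]
  | succ i ih =>
    intro p hp
    rw [selected, Finset.mem_union] at hp
    rcases hp with hp | hp
    · exact ih p hp
    · split_ifs at hp
      · obtain ⟨e, he, rfl | rfl⟩ := mem_legs.1 hp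
        · exact ⟨(mem_of_mem_star he).2.1, Or.inr rfl⟩
        · exact ⟨(mem_of_mem_star he).2.2, Or.inl rfl⟩
      · simp at hp

theorem spanner_subset (T : ℕ) : spanner E r T ⊆ E := by
  refine Finset.union_subset (fun p hp => ?_) (uncovered_subset T)
  obtain ⟨c, -, hp⟩ := Finset.mem_biUnion.1 hp
  exact (selected_subset T c p hp).1

theorem mem_uncovered_or_exists_selected (i : ℕ) {e : ℕ × ℕ} (he : e ∈ E) :
    e ∈ uncovered E r i ∨
      ∃ c ∈ verts E, (e.1, c) ∈ selected E r i c ∧ (c, e.2) ∈ selected E r i c := by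
  induction i with
  | zero => exact Or.inl he
  | succ i ih =>
    rcases ih with h | ⟨c, hc, h1, h2⟩
    · by_cases h' : e ∈ uncovered E r (i + 1)
      · exact Or.inl h'
      · rw [uncovered, mem_residual, not_and, not_not] at h'
        obtain ⟨c, hacc, hec⟩ := h' h
        refine Or.inr ⟨c, mem_verts_of_lv_pos hacc.1.1, ?_, ?_⟩
        · rw [selected, if_pos hacc]
          exact Finset.mem_union_right _ (mem_legs.2 ⟨e, hec, Or.inl rfl⟩)
        · rw [selected, if_pos hacc]
          exact Finset.mem_union_right _ (mem_legs.2 ⟨e, hec, Or.inr rfl⟩)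
    · exact Or.inr ⟨c, hc, by rw [selected]; exact Finset.mem_union_left _ h1,
        by rw [selected]; exact Finset.mem_union_left _ h2⟩

theorem spanner_spans (T : ℕ) {e : ℕ × ℕ} (he : e ∈ E) :
    e ∈ spanner E r T ∨ ∃ c, (e.1, c) ∈ spanner E r T ∧ (c, e.2) ∈ spanner E r T := by
  rcases mem_uncovered_or_exists_selected (r := r) T he with h | ⟨c, hc, h1, h2⟩
  · exact Or.inl (Finset.mem_union_right _ h)
  · exact Or.inr ⟨c, Finset.mem_union_left _ (Finset.mem_biUnion.2 ⟨c, hc, h1⟩),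
      Finset.mem_union_left _ (Finset.mem_biUnion.2 ⟨c, hc, h2⟩)⟩

theorem coverLevel_pos (i : ℕ) {e : ℕ × ℕ} (he : e ∈ E \ uncovered E r i) :
    0 < coverLevel E r i e := by
  induction i with
  | zero => simp [uncovered] at he
  | succ i ih =>
    rw [coverLevel]
    rw [Finset.mem_sdiff] at he
    split_ifs with h
    · obtain ⟨c, hc, hec⟩ := exists_isCand_of_mem_sdiff_residual (Finset.mem_sdiff.2 ⟨h, he.2⟩)
      rw [hc.edgeLevel_eq hec]
      exact hc.1
    · exact ih (Finset.mem_sdiff.2 ⟨he.1, h⟩)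

/-- The edges of the accepted stars are paid for by the edges they cover. -/
theorem card_biUnion_selected_le (T : ℕ) :
    (((verts E).biUnion (selected E r T)).card : ℝ) ≤
      ∑ e ∈ E \ uncovered E r T, 32 / 2 ^ coverLevel E r T e := by
  classical
  induction T with
  | zero =>
    have h : (verts E).biUnion (selected E r 0) = ∅ := by ext; simp [selected]
    simp [h, uncovered]
  | succ i ih =>
    set U := uncovered E r i with hU
    have hnew : ((verts E).biUnion (selected E r (i + 1))).card ≤
        ((verts E).biUnion (selected E r i)).card +
          ∑ c ∈ (verts E).filter (Accepted E U (r i)), (legs c (star E U c)).card := by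
      refine le_trans (Finset.card_le_card fun p hp => ?_)
        ((Finset.card_union_le _ (((verts E).filter (Accepted E U (r i))).biUnion
          fun c => legs c (star E U c))).trans (add_le_add_right Finset.card_biUnion_le _))
      obtain ⟨c, hc, hp⟩ := Finset.mem_biUnion.1 hp
      rw [selected, Finset.mem_union] at hp
      rcases hp with hp | hp
      · exact Finset.mem_union_left _ (Finset.mem_biUnion.2 ⟨c, hc, hp⟩)
      · split_ifs at hp with hacc
        · exact Finset.mem_union_right _
            (Finset.mem_biUnion.2 ⟨c, Finset.mem_filter.2 ⟨hc, hacc⟩, hp⟩)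
        · simp at hp
    have hsplit : E \ uncovered E r (i + 1) = (E \ U) ∪ (U \ uncovered E r (i + 1)) := by
      have h1 := uncovered_subset (E := E) (r := r) i
      have h2 := uncovered_succ_subset (E := E) (r := r) i
      ext e
      simp only [Finset.mem_sdiff, Finset.mem_union]
      constructor
      · rintro ⟨h3, h4⟩
        by_cases h5 : e ∈ U
        · exact Or.inr ⟨h5, h4⟩
        · exact Or.inl ⟨h3, h5⟩
      · rintro (⟨h3, h4⟩ | ⟨h3, h4⟩)
        · exact ⟨h3, fun h => h4 (h2 h)⟩
        · exact ⟨h1 h3, h4⟩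
    have hdisj : Disjoint (E \ U) (U \ uncovered E r (i + 1)) :=
      Finset.disjoint_left.2 fun e h1 h2 =>
        (Finset.mem_sdiff.1 h1).2 (Finset.mem_sdiff.1 h2).1
    rw [hsplit, Finset.sum_union hdisj]
    have h1 : ∑ e ∈ E \ U, (32 : ℝ) / 2 ^ coverLevel E r (i + 1) e =
        ∑ e ∈ E \ U, 32 / 2 ^ coverLevel E r i e := by
      refine Finset.sum_congr rfl fun e he => ?_
      rw [coverLevel, if_neg (Finset.mem_sdiff.1 he).2]
    have h2 : ∑ e ∈ U \ uncovered E r (i + 1), (32 : ℝ) / 2 ^ coverLevel E r (i + 1) e =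
        ∑ e ∈ U \ residual E U (r i), 32 / 2 ^ edgeLevel E U e := by
      refine Finset.sum_congr rfl fun e he => ?_
      rw [coverLevel, if_pos (Finset.mem_sdiff.1 he).1]
    rw [h1, h2]
    refine le_trans ?_ (add_le_add ih (sum_card_legs_le (E := E) (U := U) (r := r i)))
    exact_mod_cast hnew

/-- Of the edges which are `2`-spanned by a fixed star, few are covered at low levels: when the
first of them is, the star is sparse, and it contains all the others. -/
theorem card_filter_coverLevel_le (T l x : ℕ) {A B : Finset ℕ} (hA : ∀ a ∈ A, (a, x) ∈ E)
    (hB : ∀ b ∈ B, (x, b) ∈ E) :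
    (((E \ uncovered E r T) ∩ A ×ˢ B).filter fun e => coverLevel E r T e ≤ l).card ≤
      2 ^ l * (A.card + B.card) := by
  have key : ∀ i, (∀ e ∈ (E \ uncovered E r i) ∩ A ×ˢ B, l < coverLevel E r i e) ∨
      ((E ∩ A ×ˢ B).filter fun e => e ∈ uncovered E r i ∨ coverLevel E r i e ≤ l).card ≤
        2 ^ l * (A.card + B.card) := by
    intro i
    induction i with
    | zero => exact Or.inl (by simp [uncovered])
    | succ i ih =>
      rcases ih with ih | ih
      · by_cases hex : ∃ e ∈ (uncovered E r i \ uncovered E r (i + 1)) ∩ A ×ˢ B,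
            edgeLevel E (uncovered E r i) e ≤ l
        · obtain ⟨e, he, hel⟩ := hex
          obtain ⟨he1, he2⟩ := Finset.mem_inter.1 he
          refine Or.inr (le_trans (Finset.card_le_card fun f hf => ?_)
            (card_le_of_edgeLevel_le he1 hel hA hB (Finset.mem_product.1 he2).1))
          obtain ⟨hf1, hf2⟩ := Finset.mem_filter.1 hf
          obtain ⟨hf3, hf4⟩ := Finset.mem_inter.1 hf1
          refine Finset.mem_inter.2 ⟨?_, hf4⟩
          by_contra hfU
          rcases hf2 with hf2 | hf2
          · exact hfU (uncovered_succ_subset i hf2)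
          · rw [coverLevel, if_neg hfU] at hf2
            have := ih f (Finset.mem_inter.2 ⟨Finset.mem_sdiff.2 ⟨hf3, hfU⟩, hf4⟩)
            omega
        · push Not at hex
          refine Or.inl fun e he => ?_
          obtain ⟨he1, he2⟩ := Finset.mem_inter.1 he
          obtain ⟨he3, he4⟩ := Finset.mem_sdiff.1 he1
          rw [coverLevel]
          split_ifs with h
          · exact hex e (Finset.mem_inter.2 ⟨Finset.mem_sdiff.2 ⟨h, he4⟩, he2⟩)
          · exact ih e (Finset.mem_inter.2 ⟨Finset.mem_sdiff.2 ⟨he3, h⟩, he2⟩)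
      · refine Or.inr ((Finset.card_le_card fun e he => ?_).trans ih)
        obtain ⟨he1, he2⟩ := Finset.mem_filter.1 he
        refine Finset.mem_filter.2 ⟨he1, ?_⟩
        by_cases hU : e ∈ uncovered E r i
        · exact Or.inl hU
        · rcases he2 with he2 | he2
          · exact absurd (uncovered_succ_subset i he2) hU
          · rw [coverLevel, if_neg hU] at he2
            exact Or.inr he2
  rcases key T with h | h
  · rw [Finset.filter_false_of_mem fun e he => not_le.2 (h e he)]
    simp
  · refine (Finset.card_le_card fun e he => ?_).trans h
    obtain ⟨he1, he2⟩ := Finset.mem_filter.1 he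
    obtain ⟨he3, he4⟩ := Finset.mem_inter.1 he1
    exact Finset.mem_filter.2
      ⟨Finset.mem_inter.2 ⟨(Finset.mem_sdiff.1 he3).1, he4⟩, Or.inr he2⟩

theorem sum_filter_coverLevel_le (T J x : ℕ) {A B : Finset ℕ} (hA : ∀ a ∈ A, (a, x) ∈ E)
    (hB : ∀ b ∈ B, (x, b) ∈ E) :
    ∑ e ∈ ((E \ uncovered E r T) ∩ A ×ˢ B).filter (fun e => coverLevel E r T e ≤ J),
      (32 : ℝ) / 2 ^ coverLevel E r T e ≤ 32 * J * (A.card + B.card) := by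
  have hmaps : ∀ e ∈ ((E \ uncovered E r T) ∩ A ×ˢ B).filter (fun e => coverLevel E r T e ≤ J),
      coverLevel E r T e ∈ Finset.Icc 1 J := fun e he => by
    obtain ⟨he1, he2⟩ := Finset.mem_filter.1 he
    exact Finset.mem_Icc.2 ⟨coverLevel_pos T (Finset.mem_inter.1 he1).1, he2⟩
  rw [← Finset.sum_fiberwise_of_maps_to hmaps]
  have hle : ∀ l ∈ Finset.Icc 1 J,
      ∑ e ∈ (((E \ uncovered E r T) ∩ A ×ˢ B).filter (fun e => coverLevel E r T e ≤ J)).filter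
        (fun e => coverLevel E r T e = l), (32 : ℝ) / 2 ^ coverLevel E r T e ≤
        32 * (A.card + B.card) := by
    intro l _
    rw [Finset.sum_congr rfl (g := fun _ => (32 : ℝ) / 2 ^ l)
      fun e he => by rw [(Finset.mem_filter.1 he).2], Finset.sum_const, nsmul_eq_mul,
      ← mul_div_assoc, div_le_iff₀ (by positivity)]
    have h1 := card_filter_coverLevel_le (r := r) T l x hA hB
    have h2 : ((((E \ uncovered E r T) ∩ A ×ˢ B).filter
        (fun e => coverLevel E r T e ≤ J)).filter (fun e => coverLevel E r T e = l)).card ≤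
        2 ^ l * (A.card + B.card) := by
      refine (Finset.card_le_card fun e he => ?_).trans h1
      obtain ⟨he1, he2⟩ := Finset.mem_filter.1 he
      exact Finset.mem_filter.2 ⟨(Finset.mem_filter.1 he1).1, he2.le⟩
    have h3 : (_ : ℝ) ≤ _ := Nat.cast_le.2 h2
    push_cast at h3
    linarith
  refine (Finset.sum_le_sum hle).trans ?_
  rw [Finset.sum_const, Nat.card_Icc, nsmul_eq_mul]
  simp only [Nat.add_sub_cancel]
  linarith

/-- The cost of the process compared with the size of an arbitrary `2`-spanner `H`. The edges that
are covered at a level above the threshold `J` cost little; the others are grouped according to the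
stars of `H` that `2`-span them. -/
theorem card_spanner_le {T : ℕ} (hT : ∀ c, lv E (uncovered E r T) c = 0) (J : ℕ)
    {H : Finset (ℕ × ℕ)} (hHE : H ⊆ E)
    (hH : ∀ e ∈ E, e ∈ H ∨ ∃ x, (e.1, x) ∈ H ∧ (x, e.2) ∈ H) :
    ((spanner E r T).card : ℝ) ≤ (17 + 64 * J) * H.card + 32 * E.card / 2 ^ J := by
  have hUH : uncovered E r T ⊆ H := fun e he => by
    rcases hH e (uncovered_subset T he) with h | ⟨x, h1, h2⟩
    · exact h
    · have h3 : 0 < lv E (uncovered E r T) x :=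
        lv_pos.2 ⟨e, mem_spanPairs.2 ⟨he, hHE h1, hHE h2⟩⟩
      exact absurd (hT x) h3.ne'
  set A : ℕ → Finset ℕ := fun x => (H.filter fun f => f.2 = x).image Prod.fst with hAdef
  set B : ℕ → Finset ℕ := fun x => (H.filter fun f => f.1 = x).image Prod.snd with hBdef
  have memA : ∀ {x a}, a ∈ A x ↔ (a, x) ∈ H := fun {x a} => by
    simp [hAdef]
  have memB : ∀ {x b}, b ∈ B x ↔ (x, b) ∈ H := fun {x b} => by
    simp [hBdef]
  have hAB : ∑ x ∈ verts E, (((A x).card : ℝ) + (B x).card) ≤ 2 * H.card := by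
    have h1 : ∑ x ∈ verts E, (A x).card ≤ H.card := by
      rw [Finset.card_eq_sum_card_fiberwise (f := Prod.snd) (s := H) (t := verts E)]
      · exact Finset.sum_le_sum fun x _ => Finset.card_image_le
      · intro e he
        exact Finset.mem_union_right _ (Finset.mem_image_of_mem _ (hHE he))
    have h2 : ∑ x ∈ verts E, (B x).card ≤ H.card := by
      rw [Finset.card_eq_sum_card_fiberwise (f := Prod.fst) (s := H) (t := verts E)]
      · exact Finset.sum_le_sum fun x _ => Finset.card_image_le
      · intro e he
        exact Finset.mem_union_left _ (Finset.mem_image_of_mem _ (hHE he))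
    rw [Finset.sum_add_distrib]
    have h3 : (_ : ℝ) ≤ _ := Nat.cast_le.2 h1
    have h4 : (_ : ℝ) ≤ _ := Nat.cast_le.2 h2
    push_cast at h3 h4
    linarith
  set D := E \ uncovered E r T with hD
  set p : ℕ × ℕ → ℝ := fun e => 32 / 2 ^ coverLevel E r T e with hp
  have hp0 : ∀ e, 0 ≤ p e := fun e => by positivity
  -- an edge of `H` pays at most `16`, since its level is positive
  have hpoint : ∀ e ∈ D, p e ≤ (if e ∈ H then 16 else 0) +
      (∑ x ∈ verts E, if e ∈ A x ×ˢ B x ∧ coverLevel E r T e ≤ J then p e else 0) +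
      32 / 2 ^ J := by
    intro e he
    have hs : 0 ≤ ∑ x ∈ verts E,
        (if e ∈ A x ×ˢ B x ∧ coverLevel E r T e ≤ J then p e else 0) :=
      Finset.sum_nonneg fun x _ => by split_ifs <;> simp [hp0]
    have hJ : (0 : ℝ) ≤ 32 / 2 ^ J := by positivity
    rcases hH e (Finset.mem_sdiff.1 he).1 with h | ⟨x, h1, h2⟩
    · rw [if_pos h]
      have : p e ≤ 16 := by
        rw [hp, div_le_iff₀ (by positivity)]
        have := pow_le_pow_right₀ (one_le_two (α := ℝ)) (coverLevel_pos T he)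
        norm_num at this
        linarith
      linarith
    · have hi : (0 : ℝ) ≤ if e ∈ H then 16 else 0 := by split_ifs <;> norm_num
      by_cases hl : coverLevel E r T e ≤ J
      · have hx : x ∈ verts E :=
          Finset.mem_union_right _ (Finset.mem_image.2 ⟨_, hHE h1, rfl⟩)
        have := Finset.single_le_sum
          (f := fun x => if e ∈ A x ×ˢ B x ∧ coverLevel E r T e ≤ J then p e else 0)
          (fun x _ => by split_ifs <;> simp [hp0]) hx
        rw [if_pos ⟨Finset.mem_product.2 ⟨memA.2 h1, memB.2 h2⟩, hl⟩] at this
        linarith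
      · have : p e ≤ 32 / 2 ^ J := by
          simp only [hp]
          gcongr
          · norm_num
          · omega
        linarith
  have hsum := (card_biUnion_selected_le (E := E) (r := r) T).trans (Finset.sum_le_sum hpoint)
  rw [Finset.sum_add_distrib, Finset.sum_add_distrib, Finset.sum_comm] at hsum
  have h1 : ∑ e ∈ D, (if e ∈ H then (16 : ℝ) else 0) ≤ 16 * H.card := by
    rw [← Finset.sum_filter, Finset.sum_const, nsmul_eq_mul, mul_comm]
    gcongr
    exact fun e he => (Finset.mem_filter.1 he).2
  have h2 : ∑ x ∈ verts E, ∑ e ∈ D,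
      (if e ∈ A x ×ˢ B x ∧ coverLevel E r T e ≤ J then p e else 0) ≤ 64 * J * H.card := by
    have : ∀ x ∈ verts E, ∑ e ∈ D,
        (if e ∈ A x ×ˢ B x ∧ coverLevel E r T e ≤ J then p e else 0) ≤
        32 * J * ((A x).card + (B x).card) := by
      intro x _
      rw [← Finset.sum_filter]
      refine le_trans (le_of_eq ?_) (sum_filter_coverLevel_le (E := E) (r := r) T J x
        (A := A x) (B := B x) (fun a ha => hHE (memA.1 ha)) (fun b hb => hHE (memB.1 hb)))
      refine Finset.sum_congr ?_ fun _ _ => rfl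
      ext e
      simp only [Finset.mem_filter, Finset.mem_inter, and_assoc, hD]
    refine (Finset.sum_le_sum this).trans ?_
    rw [← Finset.mul_sum]
    calc 32 * (J : ℝ) * ∑ x ∈ verts E, (((A x).card : ℝ) + (B x).card)
        ≤ 32 * J * (2 * H.card) := by gcongr
      _ = 64 * J * H.card := by ring
  have h3 : ∑ e ∈ D, (32 : ℝ) / 2 ^ J ≤ 32 * E.card / 2 ^ J := by
    rw [Finset.sum_const, nsmul_eq_mul, ← mul_div_assoc, mul_comm]
    gcongr
    exact Finset.sdiff_subset
  have h4 : ((spanner E r T).card : ℝ) ≤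
      ((verts E).biUnion (selected E r T)).card + H.card := by
    exact_mod_cast (Finset.card_union_le _ _).trans
      (add_le_add_right (Finset.card_le_card hUH) _)
  linarith

end Covering

/-! ### Voting by random ranks -/

section Voting

theorem sum_sum_div_add_eq {β : Type*} {s : β → ℝ} {Q : Finset β} (hs : ∀ e ∈ Q, 0 < s e) :
    ∑ e ∈ Q, ∑ f ∈ Q, s e / (s e + s f) = (Q.card : ℝ) ^ 2 / 2 := by
  have h : ∑ e ∈ Q, ∑ f ∈ Q, s e / (s e + s f) + ∑ e ∈ Q, ∑ f ∈ Q, s e / (s e + s f) =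
      (Q.card : ℝ) ^ 2 := by
    conv_lhs => arg 2; rw [Finset.sum_comm]
    rw [← Finset.sum_add_distrib]
    have : ∀ e ∈ Q, (∑ f ∈ Q, s e / (s e + s f)) + ∑ f ∈ Q, s f / (s f + s e) = Q.card := by
      intro e he
      rw [← Finset.sum_add_distrib, Finset.sum_congr rfl (g := fun _ => (1 : ℝ)), Finset.sum_const,
        nsmul_eq_mul, mul_one]
      intro f hf
      have h1 := hs e he
      have h2 := hs f hf
      rw [add_comm (s f), ← add_div, div_self (by positivity)]
    rw [Finset.sum_congr rfl this, Finset.sum_const, nsmul_eq_mul, sq]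
  linarith

variable {V : Type*} [Fintype V] [DecidableEq V] {k : ℕ}

/-- The rank functions for which `v` has the strictly smallest rank in `M`. -/
def firstIn (k : ℕ) (M : Finset V) (v : V) : Finset (V → Fin k) :=
  Finset.univ.filter fun x => ∀ u ∈ M, u ≠ v → x v < x u

theorem mem_firstIn {M : Finset V} {v : V} {x : V → Fin k} :
    x ∈ firstIn k M v ↔ ∀ u ∈ M, u ≠ v → x v < x u := by simp [firstIn]

theorem card_firstIn_le_card_firstIn {M : Finset V} {v w : V} (hv : v ∈ M) (hw : w ∈ M) :
    (firstIn k M v).card ≤ (firstIn k M w).card := by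
  refine Finset.card_le_card_of_injOn (fun x => x ∘ Equiv.swap v w) (fun x hx => ?_)
    fun x _ y _ hxy => (Equiv.swap v w).surjective.injective_comp_right hxy
  refine mem_firstIn.2 fun u hu huw => ?_
  have hx := mem_firstIn.1 (Finset.mem_coe.1 hx)
  simp only [Function.comp_apply, Equiv.swap_apply_right]
  refine hx _ ?_ fun h => huw ?_
  · rcases eq_or_ne u v with rfl | h1
    · simpa using hw
    · rw [Equiv.swap_apply_of_ne_of_ne h1 huw]
      exact hu
  · simpa using congrArg (Equiv.swap v w) h

theorem disjoint_firstIn {M : Finset V} {v w : V} (hv : v ∈ M) (hw : w ∈ M) (hvw : v ≠ w) :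
    Disjoint (firstIn k M v) (firstIn k M w) :=
  Finset.disjoint_left.2 fun _ h1 h2 =>
    lt_asymm (mem_firstIn.1 h1 w hw hvw.symm) (mem_firstIn.1 h2 v hv hvw)

theorem card_mul_card_firstIn {M : Finset V} {v : V} (hv : v ∈ M) :
    M.card * (firstIn k M v).card = (M.biUnion (firstIn k M)).card := by
  rw [Finset.card_biUnion fun u hu w hw huw => disjoint_firstIn hu hw huw, ← smul_eq_mul,
    ← Finset.sum_const]
  exact Finset.sum_congr rfl fun w hw =>
    (card_firstIn_le_card_firstIn hv hw).antisymm (card_firstIn_le_card_firstIn hw hv)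

theorem card_mul_card_firstIn_le {M : Finset V} {v : V} (hv : v ∈ M) :
    M.card * (firstIn k M v).card ≤ k ^ Fintype.card V := by
  rw [card_mul_card_firstIn hv]
  have := Finset.card_le_univ (M.biUnion (firstIn k M))
  rwa [Fintype.card_fun, Fintype.card_fin] at this

/-- Two given vertices have the same rank with probability at most `1 / k`. -/
theorem mul_card_filter_eq_le {u w : V} (huw : u ≠ w) :
    k * (Finset.univ.filter fun x : V → Fin k => x u = x w).card ≤ k ^ Fintype.card V := by
  have h : ((Finset.univ : Finset (Fin k)) ×ˢ
      Finset.univ.filter fun x : V → Fin k => x u = x w).card ≤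
      (Finset.univ : Finset (V → Fin k)).card := by
    refine Finset.card_le_card_of_injOn (fun p => Function.update p.2 u p.1) (fun _ _ => by simp)
      fun p hp q hq hpq => ?_
    have hp := (Finset.mem_filter.1 (Finset.mem_product.1 (Finset.mem_coe.1 hp)).2).2
    have hq := (Finset.mem_filter.1 (Finset.mem_product.1 (Finset.mem_coe.1 hq)).2).2
    have hv : ∀ v, v ≠ u → p.2 v = q.2 v := fun v hv => by
      have := congrFun hpq v
      simpa [hv] using this
    refine Prod.ext ?_ (funext fun v => ?_)
    · have := congrFun hpq u
      simpa using this
    · rcases eq_or_ne v u with rfl | h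
      · rw [hp, hq, hv w huw.symm]
      · exact hv v h
  simpa [Finset.card_product] using h

/-- If there are many ranks, then each element of `M` has the strictly smallest rank with
probability at least `0.9 / |M|`. -/
theorem le_card_mul_card_firstIn {M : Finset V} (hk : 10 * Fintype.card V ^ 2 ≤ k) {v : V}
    (hv : v ∈ M) : 9 * k ^ Fintype.card V ≤ 10 * (M.card * (firstIn k M v).card) := by
  have hcover : (Finset.univ : Finset (V → Fin k)) ⊆ M.biUnion (firstIn k M) ∪
      M.offDiag.biUnion fun p => Finset.univ.filter fun x : V → Fin k => x p.1 = x p.2 := by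
    intro x _
    obtain ⟨w, hw, hmin⟩ := M.exists_min_image x ⟨v, hv⟩
    by_cases h : x ∈ firstIn k M w
    · exact Finset.mem_union_left _ (Finset.mem_biUnion.2 ⟨w, hw, h⟩)
    · rw [mem_firstIn] at h
      push Not at h
      obtain ⟨u, hu, huw, hle⟩ := h
      refine Finset.mem_union_right _ (Finset.mem_biUnion.2
        ⟨(u, w), Finset.mem_offDiag.2 ⟨hu, hw, huw⟩, ?_⟩)
      simpa using hle.antisymm (hmin u hu)
  have h1 := (Finset.card_le_card hcover).trans (Finset.card_union_le _ _)
  rw [← card_mul_card_firstIn hv, Finset.card_univ, Fintype.card_fun, Fintype.card_fin] at h1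
  set F := M.offDiag.biUnion fun p => Finset.univ.filter fun x : V → Fin k => x p.1 = x p.2
  have h2 : k * F.card ≤ M.offDiag.card * k ^ Fintype.card V := by
    refine (Nat.mul_le_mul_left k Finset.card_biUnion_le).trans ?_
    rw [Finset.mul_sum, ← smul_eq_mul, ← Finset.sum_const]
    exact Finset.sum_le_sum fun p hp => mul_card_filter_eq_le (Finset.mem_offDiag.1 hp).2.2
  have h3 : M.offDiag.card ≤ Fintype.card V ^ 2 := by
    have : M.card ≤ Fintype.card V := Finset.card_le_univ M
    rw [Finset.offDiag_card, sq]
    exact (Nat.sub_le _ _).trans (Nat.mul_le_mul this this)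
  have hn : 0 < Fintype.card V := Fintype.card_pos_iff.2 ⟨v⟩
  have hk0 : 0 < k := lt_of_lt_of_le (by positivity) hk
  have h4 : 10 * F.card ≤ k ^ Fintype.card V := by
    refine Nat.le_of_mul_le_mul_left (?_ : k * (10 * F.card) ≤ k * k ^ Fintype.card V) hk0
    calc k * (10 * F.card) = 10 * (k * F.card) := by ring
      _ ≤ 10 * (Fintype.card V ^ 2 * k ^ Fintype.card V) :=
        Nat.mul_le_mul_left 10 (h2.trans (Nat.mul_le_mul_right _ h3))
      _ = (10 * Fintype.card V ^ 2) * k ^ Fintype.card V := by ring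
      _ ≤ k * k ^ Fintype.card V := Nat.mul_le_mul_right _ hk
  omega

theorem firstIn_union {M M' : Finset V} {v : V} :
    firstIn k (M ∪ M') v = firstIn k M v ∩ firstIn k M' v := by
  ext x
  simp only [mem_firstIn, Finset.mem_inter, Finset.mem_union]
  exact ⟨fun h => ⟨fun u hu => h u (Or.inl hu), fun u hu => h u (Or.inr hu)⟩,
    fun h u hu => hu.elim (h.1 u) (h.2 u)⟩

variable {β : Type*} [DecidableEq β]

/-- The centres whose stars `2`-span `e`, if the star of `v` `2`-spans `S v`. -/
def centres (S : V → Finset β) (e : β) : Finset V := Finset.univ.filter fun v => e ∈ S v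

/-- The elements of `S v` for which `v` is strictly the first centre. -/
def votesFor (S : V → Finset β) (v : V) (x : V → Fin k) : Finset β :=
  (S v).filter fun e => x ∈ firstIn k (centres S e) v

/-- If an element `e` votes for `v`, then every other element `f` of `S v` does so with conditional
probability at least about `s e / (s e + s f)`, where `s` counts the centres. On average this is a
half, so that `v` probably obtains at least an eighth of the votes. -/
theorem le_sum_sum_votesFor (S : V → Finset β) (hk : 10 * Fintype.card V ^ 2 ≤ k) (v : V) :
    (k : ℝ) ^ Fintype.card V * (S v).card ≤ 4 * ∑ x : V → Fin k,
      if (S v).card ≤ 8 * (votesFor S v x).card then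
        ∑ e ∈ votesFor S v x, ((centres S e).card : ℝ) else 0 := by
  set K : ℝ := (k : ℝ) ^ Fintype.card V with hK
  set q : ℝ := ((S v).card : ℝ) with hq
  rcases (S v).eq_empty_or_nonempty with hS | hS
  · have : q = 0 := by simp [hq, hS]
    rw [this, mul_zero]
    refine mul_nonneg (by norm_num) (Finset.sum_nonneg fun x _ => ?_)
    split_ifs
    · exact Finset.sum_nonneg fun e _ => Nat.cast_nonneg _
    · exact le_rfl
  have hq0 : 0 < q := Nat.cast_pos.2 hS.card_pos
  set s : β → ℝ := fun e => (centres S e).card with hs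
  set A : β → Finset (V → Fin k) := fun e => firstIn k (centres S e) v with hA
  have hmem : ∀ e ∈ S v, v ∈ centres S e := fun e he => by simpa [centres] using he
  have hs0 : ∀ e ∈ S v, 0 < s e := fun e he =>
    Nat.cast_pos.2 (Finset.card_pos.2 ⟨v, hmem e he⟩)
  have hup : ∀ e ∈ S v, s e * (A e).card ≤ K := fun e he => by
    have : (_ : ℝ) ≤ _ := Nat.cast_le.2 (card_mul_card_firstIn_le (k := k) (hmem e he))
    push_cast at this
    exact this
  have hlow : ∀ e ∈ S v, 0.9 * K ≤ s e * (A e).card := fun e he => by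
    have : (_ : ℝ) ≤ _ := Nat.cast_le.2 (le_card_mul_card_firstIn hk (hmem e he))
    push_cast at this
    simp only [hs, hA, hK]
    linarith
  have hK0 : 0 ≤ K := by positivity
  -- `e` and `f` both vote for `v` if `v` comes first in the union of their sets of centres
  have hpair : ∀ e ∈ S v, ∀ f ∈ S v, s e * ((A e).card - (A e ∩ A f).card) ≤
      K - 0.9 * K * (s e / (s e + s f)) := fun e he f hf => by
    have h1 : (_ : ℝ) ≤ _ := Nat.cast_le.2 (le_card_mul_card_firstIn hk
      (Finset.mem_union_left (centres S f) (hmem e he)))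
    rw [firstIn_union] at h1
    have h2 : (((centres S e ∪ centres S f).card : ℕ) : ℝ) ≤ s e + s f := by
      have : (_ : ℝ) ≤ _ := Nat.cast_le.2 (Finset.card_union_le (centres S e) (centres S f))
      rwa [Nat.cast_add] at this
    push_cast at h1
    have h3 := hs0 e he
    have h4 := hs0 f hf
    have h5 : 0.9 * K ≤ (s e + s f) * (A e ∩ A f).card := by
      have := mul_le_mul_of_nonneg_right h2 (Nat.cast_nonneg (α := ℝ) (A e ∩ A f).card)
      simp only [hA] at this ⊢
      linarith
    have h6 : 0.9 * K / (s e + s f) ≤ (A e ∩ A f).card := by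
      rw [div_le_iff₀ (by positivity)]
      linarith
    have h7 := mul_le_mul_of_nonneg_left h6 h3.le
    have h8 : 0.9 * K * (s e / (s e + s f)) = s e * (0.9 * K / (s e + s f)) := by ring
    have := hup e he
    rw [h8, mul_sub]
    linarith
  set Y : (V → Fin k) → ℝ := fun x => ∑ e ∈ votesFor S v x, s e with hY
  set X : (V → Fin k) → ℝ := fun x => ((votesFor S v x).card : ℝ) with hX
  have hYeq : ∀ x, Y x = ∑ e ∈ S v, if x ∈ A e then s e else 0 := fun x => by
    rw [hY, ← Finset.sum_filter]; rfl
  have hXeq : ∀ x, q - X x = ∑ f ∈ S v, if x ∈ A f then (0 : ℝ) else 1 := fun x => by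
    have : X x = ∑ f ∈ S v, if x ∈ A f then (1 : ℝ) else 0 := by
      rw [← Finset.sum_filter, Finset.sum_const, nsmul_eq_mul, mul_one]; rfl
    rw [this, hq, Finset.card_eq_sum_ones, Nat.cast_sum, ← Finset.sum_sub_distrib]
    refine Finset.sum_congr rfl fun f _ => ?_
    split_ifs <;> simp
  have hY0 : ∀ x, 0 ≤ Y x := fun x => Finset.sum_nonneg fun e _ => by positivity
  have hXq : ∀ x, X x ≤ q := fun x =>
    Nat.cast_le.2 (Finset.card_filter_le _ _)
  have hsumY : 0.9 * K * q ≤ ∑ x, Y x := by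
    simp_rw [hYeq]
    rw [Finset.sum_comm]
    have : ∀ e ∈ S v, 0.9 * K ≤ ∑ x : V → Fin k, if x ∈ A e then s e else 0 := fun e he => by
      rw [← Finset.sum_filter, Finset.sum_const, nsmul_eq_mul, mul_comm _ (s e),
        Finset.filter_mem_eq_inter, Finset.univ_inter]
      exact hlow e he
    have := Finset.card_nsmul_le_sum _ _ _ this
    rw [nsmul_eq_mul] at this
    linarith
  have hsumYX : ∑ x, Y x * (q - X x) ≤ 0.55 * K * q ^ 2 := by
    have h1 : ∀ x, Y x * (q - X x) =
        ∑ e ∈ S v, ∑ f ∈ S v, if x ∈ A e \ A f then s e else 0 := fun x => by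
      rw [hYeq, hXeq, Finset.sum_mul_sum]
      refine Finset.sum_congr rfl fun e _ => Finset.sum_congr rfl fun f _ => ?_
      by_cases h1 : x ∈ A e <;> by_cases h2 : x ∈ A f <;> simp [h1, h2]
    simp_rw [h1]
    rw [Finset.sum_comm]
    have h2 : ∀ e ∈ S v, ∑ x : V → Fin k, ∑ f ∈ S v, (if x ∈ A e \ A f then s e else 0) ≤
        ∑ f ∈ S v, (K - 0.9 * K * (s e / (s e + s f))) := fun e he => by
      rw [Finset.sum_comm]
      refine Finset.sum_le_sum fun f hf => ?_
      rw [← Finset.sum_filter, Finset.sum_const, nsmul_eq_mul, mul_comm, Finset.filter_mem_eq_inter,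
        Finset.univ_inter]
      refine le_trans (le_of_eq ?_) (hpair e he f hf)
      rw [← Finset.card_inter_add_card_sdiff (A e) (A f)]
      push_cast
      ring
    refine (Finset.sum_le_sum h2).trans (le_of_eq ?_)
    have h3 := sum_sum_div_add_eq hs0
    simp_rw [Finset.sum_sub_distrib, ← Finset.mul_sum]
    rw [h3]
    simp only [Finset.sum_const, nsmul_eq_mul]
    rw [← hq]
    ring
  -- where `X x < q / 8`, the summand `Y x * (q - X x)` is at least `7 / 8 * q * Y x`, so that at
  -- most `8 / 7 * 0.55 * K * q` of the sum of `Y`, which is at least `0.9 * K * q`, is lost there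
  have hpoint : ∀ x, Y x * q - 8 / 7 * (Y x * (q - X x)) ≤
      q * if (S v).card ≤ 8 * (votesFor S v x).card then Y x else 0 := fun x => by
    split_ifs with h
    · have := mul_nonneg (hY0 x) (sub_nonneg.2 (hXq x))
      linarith
    · have h1 : 8 * X x < q := by
        have : (_ : ℝ) < _ := Nat.cast_lt.2 (not_le.1 h)
        rwa [Nat.cast_mul, Nat.cast_ofNat] at this
      have := mul_le_mul_of_nonneg_left (show 7 / 8 * q ≤ q - X x by linarith) (hY0 x)
      linarith
  have hfin := Finset.sum_le_sum fun x (_ : x ∈ Finset.univ) => hpoint x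
  rw [Finset.sum_sub_distrib, ← Finset.sum_mul, ← Finset.mul_sum, ← Finset.mul_sum] at hfin
  have h1 := mul_le_mul_of_nonneg_right hsumY hq0.le
  have h2 : q * (K * q) ≤ q * (4 * ∑ x : V → Fin k,
      if (S v).card ≤ 8 * (votesFor S v x).card then Y x else 0) := by
    have : 0 ≤ K * q ^ 2 := by positivity
    have h3 : 0.9 * K * q * q = 0.9 * (K * q ^ 2) := by ring
    have h4 : q * (K * q) = K * q ^ 2 := by ring
    have h5 : 0.55 * K * q ^ 2 = 0.55 * (K * q ^ 2) := by ring
    rw [h3] at h1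
    rw [h5] at hsumYX
    rw [h4]
    linarith
  exact le_of_mul_le_mul_left h2 hq0

/-- The total number of centres of the elements of the accepted sets is, on average, at least a
quarter of the largest possible one. -/
theorem le_sum_sum_centres (S : V → Finset β) (hk : 10 * Fintype.card V ^ 2 ≤ k)
    (D : (V → Fin k) → Finset β)
    (hD : ∀ x v, (S v).card ≤ 8 * (votesFor S v x).card → S v ⊆ D x) :
    (k : ℝ) ^ Fintype.card V * ∑ v, ((S v).card : ℝ) ≤
      4 * ∑ x : V → Fin k, ∑ e ∈ D x, ((centres S e).card : ℝ) := by
  rw [Finset.mul_sum]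
  refine (Finset.sum_le_sum fun v _ => le_sum_sum_votesFor S hk v).trans ?_
  rw [← Finset.mul_sum, Finset.sum_comm]
  refine mul_le_mul_of_nonneg_left (Finset.sum_le_sum fun x _ => ?_) (by norm_num)
  rw [← Finset.sum_filter, ← Finset.sum_biUnion]
  · refine Finset.sum_le_sum_of_subset_of_nonneg (fun e he => ?_) fun _ _ _ => by positivity
    obtain ⟨v, hv, he⟩ := Finset.mem_biUnion.1 he
    exact hD x v (Finset.mem_filter.1 hv).2 (Finset.mem_filter.1 he).1
  · intro v _ w _ hvw
    refine Finset.disjoint_left.2 fun e he he' => ?_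
    obtain ⟨h1, h2⟩ := Finset.mem_filter.1 he
    obtain ⟨h3, h4⟩ := Finset.mem_filter.1 he'
    exact Finset.disjoint_left.1 (disjoint_firstIn (by simpa [centres] using h1)
      (by simpa [centres] using h3) hvw) h2 h4

end Voting

/-! ### The potential of the covering process -/

section Potential

variable {V : Type*} [Fintype V] {k : ℕ} (E : Finset (ℕ × ℕ)) (ident : V → ℕ)

/-- The ranks of identifiers, given the draws of the vertices. -/
noncomputable def rankOf (x : V → Fin k) : ℕ → ℕ := Function.extend ident (fun v => (x v : ℕ)) 0

/-- The total size of the cores of level `l`, over all vertices. -/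
noncomputable def coreSize (l : ℕ) (U : Finset (ℕ × ℕ)) : ℕ :=
  ∑ v, (core l (spanPairs E U (ident v))).card

/-- The potential of the set `U` of uncovered edges. Its base `B` is so large that the contribution
of the highest nonempty level dominates those of all lower levels. -/
noncomputable def potential (B : ℝ) (Λ : ℕ) (U : Finset (ℕ × ℕ)) : ℝ :=
  ∑ l ∈ Finset.range (Λ + 1), B ^ l * coreSize E ident l U

variable {E ident}

theorem coreSize_mono {l : ℕ} {U U' : Finset (ℕ × ℕ)} (h : U' ⊆ U) :
    coreSize E ident l U' ≤ coreSize E ident l U :=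
  Finset.sum_le_sum fun _ _ => Finset.card_le_card (core_mono l (spanPairs_mono h _))

theorem coreSize_le {l : ℕ} {U : Finset (ℕ × ℕ)} :
    coreSize E ident l U ≤ Fintype.card V * U.card := by
  rw [coreSize, ← smul_eq_mul, ← Finset.card_univ, ← Finset.sum_const]
  exact Finset.sum_le_sum fun _ _ =>
    Finset.card_le_card ((core_subset _ _).trans (Finset.filter_subset _ _))

theorem coreSize_eq_zero {l : ℕ} {U : Finset (ℕ × ℕ)} (h : ∀ c, lv E U c < l) :
    coreSize E ident l U = 0 :=
  Finset.sum_eq_zero fun v _ => by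
    rw [core_eq_empty_of_level_lt (h (ident v)), Finset.card_empty]

/-- One phase reduces the expected total size of the cores of the highest level by a constant
factor. -/
theorem sum_coreSize_residual_le [DecidableEq V] (hid : Function.Injective ident)
    (hE : ∀ c ∈ verts E, ∃ v, ident v = c) (hk : 10 * Fintype.card V ^ 2 ≤ k)
    {U : Finset (ℕ × ℕ)} {L : ℕ} (hL0 : 0 < L) (hL : ∀ d, lv E U d ≤ L) :
    4 * ∑ x : V → Fin k, (coreSize E ident L (residual E U (rankOf ident x)) : ℝ) ≤
      3 * (k : ℝ) ^ Fintype.card V * coreSize E ident L U := by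
  classical
  set S : V → Finset (ℕ × ℕ) := fun v => core L (spanPairs E U (ident v)) with hS
  set D : (V → Fin k) → Finset (ℕ × ℕ) := fun x => U \ residual E U (rankOf ident x) with hD
  have hlv : ∀ v, (S v).Nonempty → lv E U (ident v) = L := fun v hv =>
    (hL _).antisymm (le_level hv)
  have hstar : ∀ v, lv E U (ident v) = L → S v = star E U (ident v) := fun v hv => by
    simp only [hS, star, topCore]
    rw [← hv]
    rfl
  have hDS : ∀ x v, (S v).card ≤ 8 * (votesFor S v x).card → S v ⊆ D x := by
    intro x v hacc
    rcases (S v).eq_empty_or_nonempty with hSv | hSv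
    · rw [hSv]
      exact Finset.empty_subset _
    have hv := hlv v hSv
    have hcand : IsCand E U (ident v) :=
      isCand_of_forall_lv_le (hv ▸ hL0) fun d => hv ▸ hL d
    have hsub : votesFor S v x ⊆ (star E U (ident v)).filter
        fun e => Votes E U (rankOf ident x) e (ident v) := by
      intro e he
      obtain ⟨he1, he2⟩ := Finset.mem_filter.1 he
      rw [hstar v hv] at he1
      refine Finset.mem_filter.2 ⟨he1, hcand, he1, fun c' hc' he' => ?_⟩
      obtain ⟨w, rfl⟩ := hE c' (mem_verts_of_lv_pos hc'.1)
      have hw : lv E U (ident w) = L := by rw [← hv, hc'.lv_eq hcand he' he1]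
      by_cases hwv : w = v
      · subst hwv
        exact Or.inr ⟨rfl, le_rfl⟩
      · refine Or.inl ?_
        rw [rankOf, hid.extend_apply, hid.extend_apply]
        exact mem_firstIn.1 he2 w (by simpa [centres, hstar w hw] using he') hwv
    have haccepted : Accepted E U (rankOf ident x) (ident v) := by
      refine ⟨hcand, ?_⟩
      rw [← hstar v hv] at hsub ⊢
      exact hacc.trans (Nat.mul_le_mul_left 8 (Finset.card_le_card hsub))
    intro e he
    rw [hstar v hv] at he
    simp only [hD, Finset.mem_sdiff, mem_residual, not_and, not_not]
    exact ⟨(mem_of_mem_star he).1, fun _ => ⟨_, haccepted, he⟩⟩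
  have hvote := le_sum_sum_centres S hk D hDS
  have hpoint : ∀ x : V → Fin k, (coreSize E ident L (residual E U (rankOf ident x)) : ℝ) +
      ∑ e ∈ D x, ((centres S e).card : ℝ) ≤ coreSize E ident L U := by
    intro x
    have h1 : ∑ e ∈ D x, (centres S e).card = ∑ v, (S v ∩ D x).card := by
      simp only [centres, Finset.card_filter]
      rw [Finset.sum_comm]
      refine Finset.sum_congr rfl fun v _ => ?_
      rw [← Finset.card_filter, Finset.filter_mem_eq_inter, Finset.inter_comm]
    have h2 : coreSize E ident L (residual E U (rankOf ident x)) + ∑ v, (S v ∩ D x).card ≤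
        coreSize E ident L U := by
      rw [coreSize, coreSize, ← Finset.sum_add_distrib]
      refine Finset.sum_le_sum fun v _ => ?_
      rw [← Finset.card_sdiff_add_card_inter (core L (spanPairs E U (ident v))) (D x)]
      refine Nat.add_le_add_right (Finset.card_le_card fun e he => ?_) _
      refine Finset.mem_sdiff.2 ⟨core_mono L (spanPairs_mono residual_subset _) he, fun heD => ?_⟩
      exact (Finset.mem_sdiff.1 heD).2 (mem_spanPairs.1 (core_subset _ _ he)).1
    rw [← h1] at h2
    exact_mod_cast h2
  have hsum := Finset.sum_le_sum fun x (_ : x ∈ Finset.univ) => hpoint x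
  rw [Finset.sum_add_distrib, Finset.sum_const, nsmul_eq_mul, Finset.card_univ, Fintype.card_fun,
    Fintype.card_fin] at hsum
  have h3 : ∑ v, ((S v).card : ℝ) = coreSize E ident L U := by
    rw [coreSize]
    push_cast
    rfl
  rw [h3] at hvote
  push_cast at hsum
  linarith

theorem potential_nonneg {B : ℝ} (hB : 0 ≤ B) {Λ : ℕ} {U : Finset (ℕ × ℕ)} :
    0 ≤ potential E ident B Λ U :=
  Finset.sum_nonneg fun l _ => by positivity

theorem potential_mono {B : ℝ} (hB : 0 ≤ B) {Λ : ℕ} {U U' : Finset (ℕ × ℕ)} (h : U' ⊆ U) :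
    potential E ident B Λ U' ≤ potential E ident B Λ U :=
  Finset.sum_le_sum fun l _ =>
    mul_le_mul_of_nonneg_left (Nat.cast_le.2 (coreSize_mono h)) (by positivity)

theorem le_potential {B : ℝ} (hB : 0 ≤ B) {Λ L : ℕ} (hL : L ≤ Λ) {U : Finset (ℕ × ℕ)} :
    B ^ L * coreSize E ident L U ≤ potential E ident B Λ U :=
  Finset.single_le_sum (f := fun l => B ^ l * (coreSize E ident l U : ℝ))
    (fun l _ => by positivity) (Finset.mem_range.2 (Nat.lt_succ_of_le hL))

theorem one_le_coreSize (hE : ∀ c ∈ verts E, ∃ v, ident v = c) {U : Finset (ℕ × ℕ)} {c : ℕ}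
    (hc : 0 < lv E U c) : 1 ≤ coreSize E ident (lv E U c) U := by
  obtain ⟨v, rfl⟩ := hE c (mem_verts_of_lv_pos hc)
  refine le_trans (Finset.card_pos.2 (star_nonempty hc)) (Finset.single_le_sum
    (f := fun w => (core (lv E U (ident v)) (spanPairs E U (ident w))).card)
    (fun _ _ => Nat.zero_le _) (Finset.mem_univ v))

theorem one_le_potential (hE : ∀ c ∈ verts E, ∃ v, ident v = c) {B : ℝ} (hB : 1 ≤ B) {Λ : ℕ}
    {U : Finset (ℕ × ℕ)} {c : ℕ} (hΛ : lv E U c ≤ Λ) (hc : 0 < lv E U c) :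
    1 ≤ potential E ident B Λ U := by
  refine le_trans ?_ (le_potential (zero_le_one.trans hB) hΛ)
  have h1 : (1 : ℝ) ≤ coreSize E ident (lv E U c) U := by exact_mod_cast one_le_coreSize hE hc
  exact one_le_mul_of_one_le_of_one_le (one_le_pow₀ hB) h1

theorem sum_range_pow_mul_coreSize_le {M : ℝ} (hM : 0 ≤ M) {U : Finset (ℕ × ℕ)}
    (hU : (Fintype.card V : ℝ) * U.card ≤ M) (L : ℕ) :
    8 * ∑ l ∈ Finset.range L, (8 * M + 1) ^ l * (coreSize E ident l U : ℝ) ≤ (8 * M + 1) ^ L := by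
  have h1 : ∀ l ∈ Finset.range L, (8 * M + 1) ^ l * (coreSize E ident l U : ℝ) ≤
      (8 * M + 1) ^ l * M := fun l _ => by
    have : (coreSize E ident l U : ℝ) ≤ Fintype.card V * U.card := by
      exact_mod_cast coreSize_le
    exact mul_le_mul_of_nonneg_left (this.trans hU) (by positivity)
  have h2 := geom_sum_mul (8 * M + 1) L
  have h3 := Finset.sum_le_sum h1
  rw [← Finset.sum_mul] at h3
  rw [add_sub_cancel_right] at h2
  linarith

/-- One phase reduces the expected potential by a constant factor. -/
theorem sum_potential_residual_le [DecidableEq V] (hid : Function.Injective ident)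
    (hE : ∀ c ∈ verts E, ∃ v, ident v = c) (hk : 10 * Fintype.card V ^ 2 ≤ k)
    {U : Finset (ℕ × ℕ)} {M : ℝ} (hM : 0 ≤ M) (hU : (Fintype.card V : ℝ) * U.card ≤ M)
    {Λ : ℕ} (hΛ : ∀ c, lv E U c ≤ Λ) :
    ∑ x : V → Fin k, potential E ident (8 * M + 1) Λ (residual E U (rankOf ident x)) ≤
      (k : ℝ) ^ Fintype.card V * (7 / 8 * potential E ident (8 * M + 1) Λ U) := by
  set B : ℝ := 8 * M + 1 with hB
  have hB0 : 0 ≤ B := by positivity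
  set K : ℝ := (k : ℝ) ^ Fintype.card V with hK
  have hK0 : 0 ≤ K := by positivity
  by_cases hpos : ∃ c, 0 < lv E U c
  · obtain ⟨c, hc, hmax⟩ := exists_forall_lv_le hpos
    set L := lv E U c with hL
    -- the lower levels contribute at most `B ^ L / 8`, the higher ones nothing
    have hpoint : ∀ x : V → Fin k,
        potential E ident B Λ (residual E U (rankOf ident x)) ≤
          B ^ L * (1 / 8) + B ^ L * coreSize E ident L (residual E U (rankOf ident x)) := by
      intro x
      set U' := residual E U (rankOf ident x) with hU'
      have hU'U : U' ⊆ U := residual_subset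
      have h1 : potential E ident B Λ U' =
          ∑ l ∈ Finset.range (L + 1), B ^ l * (coreSize E ident l U' : ℝ) := by
        refine (Finset.sum_subset (Finset.range_mono (Nat.succ_le_succ (hΛ c)))
          fun l _ hl => ?_).symm
        have h2 : coreSize E ident l U = 0 :=
          coreSize_eq_zero fun d => (hmax d).trans_lt (by simpa using hl)
        have h3 := coreSize_mono (E := E) (ident := ident) (l := l) hU'U
        rw [h2, Nat.le_zero] at h3
        rw [h3, Nat.cast_zero, mul_zero]
      rw [h1, Finset.sum_range_succ]
      have h4 : (Fintype.card V : ℝ) * U'.card ≤ M := by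
        refine le_trans ?_ hU
        have := Finset.card_le_card hU'U
        gcongr
      have h5 := sum_range_pow_mul_coreSize_le (E := E) (ident := ident) hM h4 L
      rw [← hB] at h5
      linarith
    have hsum := Finset.sum_le_sum fun x (_ : x ∈ Finset.univ) => hpoint x
    rw [Finset.sum_add_distrib, Finset.sum_const, nsmul_eq_mul, Finset.card_univ,
      Fintype.card_fun, Fintype.card_fin, ← Finset.mul_sum] at hsum
    push_cast at hsum
    rw [← hK] at hsum
    have hdrift := sum_coreSize_residual_le hid hE hk hc hmax
    rw [← hK] at hdrift
    have h1 : (1 : ℝ) ≤ coreSize E ident L U := by exact_mod_cast one_le_coreSize hE hc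
    have h2 : B ^ L * coreSize E ident L U ≤ potential E ident B Λ U := le_potential hB0 (hΛ c)
    have hBL : 0 ≤ B ^ L := by positivity
    have h3 := mul_le_mul_of_nonneg_left hdrift hBL
    have h4 := mul_le_mul_of_nonneg_left h1 (mul_nonneg hK0 hBL)
    have h5 := mul_le_mul_of_nonneg_left h2 hK0
    linarith
  · push Not at hpos
    have hzero : ∀ l, coreSize E ident l U = 0 := fun l =>
      Finset.sum_eq_zero fun v _ => by
        have h1 : spanPairs E U (ident v) = ∅ := by
          by_contra hne
          exact absurd (lv_pos.2 (Finset.nonempty_iff_ne_empty.2 hne)) (hpos _).not_gt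
        rw [h1, Finset.card_eq_zero]
        exact Finset.subset_empty.1 (core_subset _ _)
    have h0 : potential E ident B Λ U = 0 :=
      Finset.sum_eq_zero fun l _ => by rw [hzero, Nat.cast_zero, mul_zero]
    rw [h0, mul_zero, mul_zero]
    exact Finset.sum_nonpos fun x _ => h0 ▸ potential_mono hB0 residual_subset

theorem potential_le {M : ℝ} (hM : 0 ≤ M) {U : Finset (ℕ × ℕ)}
    (hU : (Fintype.card V : ℝ) * U.card ≤ M) (Λ : ℕ) :
    potential E ident (8 * M + 1) Λ U ≤ (8 * M + 1) ^ (Λ + 1) := by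
  have h := sum_range_pow_mul_coreSize_le (E := E) (ident := ident) hM hU (Λ + 1)
  have h0 : 0 ≤ potential E ident (8 * M + 1) Λ U := potential_nonneg (by positivity)
  rw [potential] at h0 ⊢
  linarith

end Potential

/-! ### Independent draws -/

section Chain

/-- The states of a process that is driven by the inputs `ξ`. -/
def chain {α β : Type*} (F : α → β → α) (a : α) (ξ : ℕ → β) : ℕ → α
  | 0 => a
  | i + 1 => F (chain F a ξ i) (ξ i)

theorem chain_congr {α β : Type*} {F : α → β → α} {a : α} {ξ ξ' : ℕ → β} {i : ℕ}
    (h : ∀ j < i, ξ j = ξ' j) : chain F a ξ i = chain F a ξ' i := by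
  induction i with
  | zero => rfl
  | succ i ih =>
    rw [chain, chain, ih fun j hj => h j (by omega), h i (by omega)]

variable {V : Type} {s : ℕ}

/-- The law of independent uniform draws. -/
noncomputable abbrev drawMeasure (V : Type) (s : ℕ) : Measure (ℕ × V → Fin (s + 1)) :=
  Measure.infinitePi fun _ : ℕ × V => (PMF.uniformOfFintype (Fin (s + 1))).toMeasure

/-- A random variable that depends on finitely many draws factors through them, and is
measurable. -/
theorem exists_eq_comp_restrict {α : Type*} (I : Finset (ℕ × V)) (X : (ℕ × V → Fin (s + 1)) → α)
    (hX : ∀ ω ω', (∀ p ∈ I, ω p = ω' p) → X ω = X ω') :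
    ∃ φ : (I → Fin (s + 1)) → α, X = fun ω => φ fun p => ω p := by
  classical
  refine ⟨fun y => X fun p => if h : p ∈ I then y ⟨p, h⟩ else 0, funext fun ω => hX _ _ ?_⟩
  intro p hp
  rw [dif_pos hp]

theorem measurable_of_forall_eq {I : Finset (ℕ × V)} {X : (ℕ × V → Fin (s + 1)) → ENNReal}
    (hX : ∀ ω ω', (∀ p ∈ I, ω p = ω' p) → X ω = X ω') : Measurable X := by
  obtain ⟨φ, rfl⟩ := exists_eq_comp_restrict I X hX
  exact (measurable_of_countable φ).comp (measurable_pi_lambda _ fun p => measurable_pi_apply _)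

/-- Random variables that depend on disjoint finite sets of draws are independent. -/
theorem lintegral_mul_eq_of_disjoint {I J : Finset (ℕ × V)} (hIJ : Disjoint I J)
    {X Y : (ℕ × V → Fin (s + 1)) → ENNReal}
    (hX : ∀ ω ω', (∀ p ∈ I, ω p = ω' p) → X ω = X ω')
    (hY : ∀ ω ω', (∀ p ∈ J, ω p = ω' p) → Y ω = Y ω') :
    ∫⁻ ω, X ω * Y ω ∂(drawMeasure V s) =
      (∫⁻ ω, X ω ∂(drawMeasure V s)) * ∫⁻ ω, Y ω ∂(drawMeasure V s) := by
  have hXm := measurable_of_forall_eq hX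
  have hYm := measurable_of_forall_eq hY
  obtain ⟨φ, hφ⟩ := exists_eq_comp_restrict I X hX
  obtain ⟨ψ, hψ⟩ := exists_eq_comp_restrict J Y hY
  have hindep : ProbabilityTheory.IndepFun (fun (ω : ℕ × V → Fin (s + 1)) (p : I) => ω p)
      (fun ω (p : J) => ω p) (drawMeasure V s) :=
    (ProbabilityTheory.iIndepFun_infinitePi (X := fun _ x => x)
      (fun _ => measurable_id)).indepFun_finset I J hIJ fun p => measurable_pi_apply p
  refine ProbabilityTheory.lintegral_mul_eq_lintegral_mul_lintegral_of_indepFun hXm hYm ?_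
  rw [hφ, hψ]
  exact hindep.comp (measurable_of_countable φ) (measurable_of_countable ψ)

theorem uncovered_eq_chain {E : Finset (ℕ × ℕ)} {ident : V → ℕ} {k : ℕ} (x : ℕ → V → Fin k)
    (i : ℕ) : uncovered E (fun j => rankOf ident (x j)) i =
      chain (fun U y => residual E U (rankOf ident y)) E x i := by
  induction i with
  | zero => rfl
  | succ i ih => rw [uncovered, chain, ih]

variable [Fintype V]

theorem drawMeasure_eval_eq (t : ℕ) (b : V → Fin (s + 1)) :
    drawMeasure V s {ω | (fun v => ω (t, v)) = b} = ((s + 1 : ENNReal) ^ Fintype.card V)⁻¹ := by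
  classical
  have h : {ω : ℕ × V → Fin (s + 1) | (fun v => ω (t, v)) = b} =
      Set.pi ↑(({t} : Finset ℕ) ×ˢ (Finset.univ : Finset V)) fun p => {b p.2} := by
    ext ω
    simp only [Set.mem_ofPred_eq, Set.mem_pi, Finset.coe_product, Set.mem_prod,
      Finset.coe_singleton, Set.mem_singleton_iff, Finset.coe_univ, Set.mem_univ, and_true,
      Prod.forall]
    constructor
    · rintro rfl t' v rfl
      rfl
    · intro h
      exact funext fun v => h t v rfl
  rw [h, Measure.infinitePi_pi _ fun _ _ => measurableSet_singleton _]
  simp only [PMF.toMeasure_apply_singleton _ _ (measurableSet_singleton _),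
    PMF.uniformOfFintype_apply, Fintype.card_fin, Finset.prod_const, Finset.card_product,
    Finset.card_singleton, one_mul, Finset.card_univ, ENNReal.inv_pow]
  push_cast
  rfl

open Classical in
theorem lintegral_ite_eval_eq (t : ℕ) (b : V → Fin (s + 1)) :
    ∫⁻ ω, (if (fun v => ω (t, v)) = b then (1 : ENNReal) else 0) ∂(drawMeasure V s) =
      ((s + 1 : ENNReal) ^ Fintype.card V)⁻¹ := by
  rw [← drawMeasure_eval_eq t b, ← lintegral_indicator_one]
  · refine lintegral_congr fun ω => ?_
    simp [Set.indicator_apply]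
  · exact (measurable_pi_lambda (fun (ω : ℕ × V → Fin (s + 1)) v => ω (t, v))
      fun v => measurable_pi_apply _) (measurableSet_singleton b)

theorem chain_eq_of_forall_mem {α : Type*} {F : α → (V → Fin (s + 1)) → α} {a : α} {τ : ℕ → ℕ}
    (hτ : StrictMono τ) {i : ℕ} {ω ω' : ℕ × V → Fin (s + 1)}
    (h : ∀ p ∈ Finset.range (τ i) ×ˢ (Finset.univ : Finset V), ω p = ω' p) :
    chain F a (fun j v => ω (τ j, v)) i = chain F a (fun j v => ω' (τ j, v)) i :=
  chain_congr fun j hj => funext fun v => h _ (by simpa using hτ hj)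

/-- If a single uniform input reduces `f` by the factor `q` on average, then `i` steps of the
process with independent uniform inputs reduce it by the factor `q ^ i`. -/
theorem lintegral_chain_le [DecidableEq V] {α : Type*} {F : α → (V → Fin (s + 1)) → α} {a : α}
    {P : α → Prop} (ha : P a) (hP : ∀ a b, P a → P (F a b)) {f : α → ENNReal} {q : ENNReal}
    (hf : ∀ a, P a → ∑ b, f (F a b) ≤ (s + 1 : ENNReal) ^ Fintype.card V * (q * f a))
    {τ : ℕ → ℕ} (hτ : StrictMono τ) (i : ℕ) :
    ∫⁻ ω, f (chain F a (fun j v => ω (τ j, v)) i) ∂(drawMeasure V s) ≤ q ^ i * f a := by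
  induction i with
  | zero => simp [chain]
  | succ i ih =>
    set μ := drawMeasure V s with hμ
    set X : (ℕ × V → Fin (s + 1)) → α := fun ω => chain F a (fun j v => ω (τ j, v)) i with hX
    have hPX : ∀ ω, P (X ω) := fun ω => by
      simp only [hX]
      clear ih hX X
      induction i with
      | zero => exact ha
      | succ j ih => exact hP _ _ ih
    set I : Finset (ℕ × V) := Finset.range (τ i) ×ˢ Finset.univ with hI
    set J : Finset (ℕ × V) := {τ i} ×ˢ Finset.univ with hJ
    have hIJ : Disjoint I J := Finset.disjoint_left.2 fun p hp hp' => by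
      simp only [hI, hJ, Finset.mem_product, Finset.mem_range, Finset.mem_singleton,
        Finset.mem_univ, and_true] at hp hp'
      omega
    have hXI : ∀ ω ω', (∀ p ∈ I, ω p = ω' p) → X ω = X ω' :=
      fun ω ω' h => chain_eq_of_forall_mem hτ h
    have hfXI : ∀ b, ∀ ω ω', (∀ p ∈ I, ω p = ω' p) → f (F (X ω) b) = f (F (X ω') b) :=
      fun b ω ω' h => by rw [hXI ω ω' h]
    have hξJ : ∀ b : V → Fin (s + 1), ∀ ω ω' : ℕ × V → Fin (s + 1), (∀ p ∈ J, ω p = ω' p) →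
        (if (fun v => ω (τ i, v)) = b then (1 : ENNReal) else 0) =
          if (fun v => ω' (τ i, v)) = b then 1 else 0 := fun b ω ω' h => by
      have : (fun v => ω (τ i, v)) = fun v => ω' (τ i, v) :=
        funext fun v => h _ (by simp [hJ])
      simp only [this]
    have hn0 : (s + 1 : ENNReal) ^ Fintype.card V ≠ 0 := pow_ne_zero _ (by simp)
    have hntop : (s + 1 : ENNReal) ^ Fintype.card V ≠ ⊤ := ENNReal.pow_ne_top (by simp)
    calc ∫⁻ ω, f (F (X ω) fun v => ω (τ i, v)) ∂μ
        = ∫⁻ ω, ∑ b, f (F (X ω) b) *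
            (if (fun v => ω (τ i, v)) = b then (1 : ENNReal) else 0) ∂μ := by
          refine lintegral_congr fun ω => ?_
          simp
      _ = ∑ b, ∫⁻ ω, f (F (X ω) b) *
            (if (fun v => ω (τ i, v)) = b then (1 : ENNReal) else 0) ∂μ :=
          lintegral_finsetSum _ fun b _ =>
            (measurable_of_forall_eq (hfXI b)).mul (measurable_of_forall_eq (hξJ b))
      _ = ∑ b, (∫⁻ ω, f (F (X ω) b) ∂μ) * ((s + 1 : ENNReal) ^ Fintype.card V)⁻¹ := by
          refine Finset.sum_congr rfl fun b _ => ?_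
          rw [lintegral_mul_eq_of_disjoint hIJ (hfXI b) (hξJ b), ← lintegral_ite_eval_eq (τ i) b]
      _ = (∫⁻ ω, ∑ b, f (F (X ω) b) ∂μ) * ((s + 1 : ENNReal) ^ Fintype.card V)⁻¹ := by
          rw [lintegral_finsetSum _ fun b _ => measurable_of_forall_eq (hfXI b), Finset.sum_mul]
      _ ≤ (∫⁻ ω, (s + 1 : ENNReal) ^ Fintype.card V * (q * f (X ω)) ∂μ) *
            ((s + 1 : ENNReal) ^ Fintype.card V)⁻¹ := by
          gcongr with ω
          exact hf _ (hPX ω)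
      _ = q * ∫⁻ ω, f (X ω) ∂μ := by
          have hm : Measurable fun ω => f (X ω) :=
            measurable_of_forall_eq fun ω ω' h => by rw [hXI ω ω' h]
          rw [lintegral_const_mul _ (hm.const_mul q), lintegral_const_mul _ hm, mul_comm,
            ← mul_assoc, ENNReal.inv_mul_cancel hn0 hntop, one_mul]
      _ ≤ q * (q ^ i * f a) := by gcongr
      _ = q ^ (i + 1) * f a := by rw [pow_succ]; ring

/-- After `T` phases, the process has come to an end with high probability, by Markov's inequality
for the potential. -/
theorem drawMeasure_exists_lv_pos_le [DecidableEq V] {E : Finset (ℕ × ℕ)} {ident : V → ℕ}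
    (hid : Function.Injective ident) (hE : ∀ c ∈ verts E, ∃ v, ident v = c)
    (hs : 10 * Fintype.card V ^ 2 ≤ s + 1) {M : ℝ} (hM : 0 ≤ M)
    (hEM : (Fintype.card V : ℝ) * E.card ≤ M) {Λ : ℕ} (hΛ : ∀ U ⊆ E, ∀ c, lv E U c ≤ Λ)
    {τ : ℕ → ℕ} (hτ : StrictMono τ) (T : ℕ) :
    drawMeasure V s {ω | ∃ c, 0 < lv E
      (uncovered E (fun i => rankOf ident fun v => ω (τ i, v)) T) c} ≤
      ENNReal.ofReal ((7 / 8) ^ T * (8 * M + 1) ^ (Λ + 1)) := by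
  set f : Finset (ℕ × ℕ) → ENNReal :=
    fun U => ENNReal.ofReal (potential E ident (8 * M + 1) Λ U) with hf
  have hB1 : 1 ≤ 8 * M + 1 := by linarith
  have hB0 : 0 ≤ 8 * M + 1 := by linarith
  have hEM' : ∀ U ⊆ E, (Fintype.card V : ℝ) * U.card ≤ M := fun U hU => by
    refine le_trans ?_ hEM
    gcongr
  have hdrift : ∀ U, U ⊆ E → ∑ x : V → Fin (s + 1), f (residual E U (rankOf ident x)) ≤
      (s + 1 : ENNReal) ^ Fintype.card V * (ENNReal.ofReal (7 / 8) * f U) := by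
    intro U hU
    have h := sum_potential_residual_le hid hE hs hM (hEM' U hU) (hΛ U hU)
    simp only [hf]
    rw [← ENNReal.ofReal_sum_of_nonneg fun _ _ => potential_nonneg hB0,
      ← ENNReal.ofReal_mul (by norm_num)]
    refine (ENNReal.ofReal_le_ofReal h).trans (le_of_eq ?_)
    rw [ENNReal.ofReal_mul (by positivity), ENNReal.ofReal_pow (by positivity),
      ENNReal.ofReal_natCast]
    push_cast
    rfl
  have hint := lintegral_chain_le (P := fun U => U ⊆ E) subset_rfl
    (fun U x hU => residual_subset.trans hU) hdrift hτ T
  have hmeas : Measurable fun ω : ℕ × V → Fin (s + 1) =>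
      f (chain (fun U x => residual E U (rankOf ident x)) E (fun j v => ω (τ j, v)) T) :=
    measurable_of_forall_eq fun ω ω' h => by rw [chain_eq_of_forall_mem hτ h]
  calc drawMeasure V s {ω | ∃ c, 0 < lv E
        (uncovered E (fun i => rankOf ident fun v => ω (τ i, v)) T) c}
      ≤ drawMeasure V s {ω | 1 ≤ f (chain (fun U x => residual E U (rankOf ident x)) E
          (fun j v => ω (τ j, v)) T)} := by
        refine measure_mono fun ω hω => ?_
        obtain ⟨c, hc⟩ := hω
        change 1 ≤ f _
        rw [← uncovered_eq_chain]
        exact ENNReal.one_le_ofReal.2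
          (one_le_potential hE hB1 (hΛ _ (uncovered_subset T) c) hc)
    _ ≤ ∫⁻ ω, f (chain (fun U x => residual E U (rankOf ident x)) E
          (fun j v => ω (τ j, v)) T) ∂(drawMeasure V s) := by
        have := mul_meas_ge_le_lintegral (μ := drawMeasure V s) hmeas 1
        rwa [one_mul] at this
    _ ≤ ENNReal.ofReal (7 / 8) ^ T * f E := hint
    _ ≤ ENNReal.ofReal ((7 / 8) ^ T * (8 * M + 1) ^ (Λ + 1)) := by
        rw [ENNReal.ofReal_mul (by positivity), ENNReal.ofReal_pow (by norm_num)]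
        gcongr
        exact ENNReal.ofReal_le_ofReal (potential_le hM hEM Λ)

end Chain

/-! ### The distributed algorithm -/

section Algorithm

open Classical in
/-- A set as a finite set; the value is irrelevant for infinite sets. -/
noncomputable def toFin {α : Type*} (S : Set α) : Finset α :=
  if h : S.Finite then h.toFinset else ∅

theorem toFin_coe {α : Type*} (S : Finset α) : toFin (S : Set α) = S := by
  simp [toFin]

/-- The memory of a vertex. -/
structure Memory where
  /-- the initial knowledge -/
  inp : LocalInput
  /-- the number of rounds since the beginning of the current phase -/
  clock : ℕ
  /-- the heads of the uncovered outgoing edges -/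
  unc : Set ℕ
  /-- the edges of the accepted stars with this centre -/
  sel : Set (ℕ × ℕ)
  /-- the density level -/
  lvl : ℕ
  /-- the edges `2`-spanned by the proposed star -/
  star : Finset (ℕ × ℕ)
  /-- the density levels seen so far in the current phase -/
  seen : Set ℕ
  /-- the rank drawn in the current phase -/
  rank : ℕ
  /-- whether the vertex is a candidate -/
  cand : Prop
  /-- the pairs `(b, c)` such that the outgoing edge with head `b` votes for `c` -/
  vote : Set (ℕ × ℕ)
  /-- whether the proposed star is accepted -/
  acc : Prop
  /-- the output, once the vertex has halted -/
  out : Option (Set (ℕ × ℕ))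

/-- The memory of a vertex before the first round. -/
def initial (inp : LocalInput) : Memory where
  inp := inp
  clock := 0
  unc := inp.outNbrs
  sel := ∅
  lvl := 0
  star := ∅
  seen := ∅
  rank := 0
  cand := False
  vote := ∅
  acc := False
  out := none

open Classical in
/-- One round of the algorithm, for a vertex with the memory `σ` that draws `x` and receives the
memories `I` of its neighbours. A phase takes six rounds. In these, the vertex learns which edges
that it can `2`-span are uncovered and proposes a star, learns the density levels of its neighbours
and those of their neighbours, lets its outgoing edges vote for candidates, counts the votes for its
own star, and finally learns which of its outgoing edges have been covered. -/
noncomputable def round (σ : Memory) (x : ℕ) (I : Set (ℕ × Memory)) : Memory :=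
  match σ.clock with
  | 0 =>
      let P := toFin {e : ℕ × ℕ | e.1 ∈ σ.inp.inNbrs ∧ e.2 ∈ σ.inp.outNbrs ∧
        ∃ s, (e.1, s) ∈ I ∧ e.2 ∈ s.unc}
      { σ with clock := 1, lvl := level P, star := topCore P, seen := {level P} }
  | 1 => { σ with clock := 2, seen := σ.seen ∪ {l | ∃ d s, (d, s) ∈ I ∧ l ∈ s.seen} }
  | 2 =>
      let S := σ.seen ∪ {l | ∃ d s, (d, s) ∈ I ∧ l ∈ s.seen}
      { σ with clock := 3, seen := S, rank := x, cand := 0 < σ.lvl ∧ ∀ l ∈ S, l ≤ σ.lvl }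
  | 3 =>
      { σ with
        clock := 4
        vote := {p | p.1 ∈ σ.unc ∧ ∃ s, (p.2, s) ∈ I ∧ s.cand ∧ (σ.inp.self, p.1) ∈ s.star ∧
          ∀ c' s', (c', s') ∈ I → s'.cand → (σ.inp.self, p.1) ∈ s'.star →
            s.rank < s'.rank ∨ (s.rank = s'.rank ∧ p.2 ≤ c')} }
  | 4 =>
      let a := σ.cand ∧ σ.star.card ≤
        8 * (σ.star.filter fun e => ∃ s, (e.1, s) ∈ I ∧ (e.2, σ.inp.self) ∈ s.vote).card
      { σ with
        clock := 5
        acc := a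
        sel := σ.sel ∪ if a then (legs σ.inp.self σ.star : Set (ℕ × ℕ)) else ∅ }
  | _ =>
      let W := σ.unc \ {b | ∃ c s, (c, s) ∈ I ∧ s.acc ∧ (σ.inp.self, b) ∈ s.star}
      { σ with
        clock := 0
        unc := W
        out := if ∀ l ∈ σ.seen, l = 0 then some (σ.sel ∪ {p | p.1 = σ.inp.self ∧ p.2 ∈ W})
          else none }

/-- The algorithm: every vertex sends its whole memory in every round. The number of possible ranks
makes it unlikely that two vertices draw the same rank. -/
noncomputable def alg : LocalAlg where
  State := Memory
  Msg := Memory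
  sides N := 10 * N ^ 2
  init := initial
  send σ _ := σ
  step := round
  output := Memory.out

/-! ### The algorithm carries out the covering process -/

variable (E : Finset (ℕ × ℕ)) (r : ℕ → ℕ → ℕ) (N : ℕ)

/-- The input of a vertex, in terms of identifiers. -/
def inputOf (c : ℕ) : LocalInput where
  bound := N
  self := c
  outNbrs := {b | (c, b) ∈ E}
  inNbrs := {a | (a, c) ∈ E}

/-- After `j` rounds of the phase `i`, the memory `σ` of the vertex `c` agrees with the covering
process. Only the entries that have been updated in the current phase matter. -/
structure Agrees (i j c : ℕ) (σ : Memory) : Prop where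
  inp : σ.inp = inputOf E N c
  unc : σ.unc = {b | (c, b) ∈ uncovered E r i}
  sel_old : j ≤ 4 → σ.sel = selected E r i c
  sel_new : 5 ≤ j → σ.sel = selected E r (i + 1) c
  lvl : 1 ≤ j → σ.lvl = lv E (uncovered E r i) c
  star : 1 ≤ j → σ.star = star E (uncovered E r i) c
  seen : 1 ≤ j → σ.seen = seen E (uncovered E r i) (min (j - 1) 2) c
  cand : 3 ≤ j → (σ.cand ↔ IsCand E (uncovered E r i) c)
  rank : 3 ≤ j → IsCand E (uncovered E r i) c → σ.rank = r i c
  vote : 4 ≤ j → ∀ b d, (b, d) ∈ σ.vote ↔ Votes E (uncovered E r i) (r i) (c, b) d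
  acc : 5 ≤ j → (σ.acc ↔ Accepted E (uncovered E r i) (r i) c)

/-- All density levels within distance two of `c` are zero at the beginning of the phase `i`. -/
def Quiet (i c : ℕ) : Prop := ∀ l ∈ TwoSpanner.seen E (uncovered E r i) 2 c, l = 0

/-- The memory `σ` is that of a vertex `c` which has halted before the phase `i`. -/
structure Halted (i c : ℕ) (σ : Memory) : Prop where
  quiet : Quiet E r i c
  inp : σ.inp = inputOf E N c
  unc : σ.unc = {b | (c, b) ∈ uncovered E r i}
  sel : σ.sel = selected E r i c
  lvl : σ.lvl = 0
  star : σ.star = ∅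
  seen : σ.seen = {0}
  cand : ¬ σ.cand
  vote : σ.vote = ∅
  acc : ¬ σ.acc
  out : σ.out = some ((selected E r i c : Set (ℕ × ℕ)) ∪ {p | p.1 = c ∧ p ∈ uncovered E r i})

variable {E r N} {i c : ℕ}

theorem seen_subset_seen_succ {U : Finset (ℕ × ℕ)} (k c : ℕ) : seen E U k c ⊆ seen E U (k + 1) c :=
  Set.subset_union_left

theorem lv_mem_seen {U : Finset (ℕ × ℕ)} (k c : ℕ) : lv E U c ∈ seen E U k c := by
  induction k with
  | zero => rfl
  | succ k ih => exact seen_subset_seen_succ k c ih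

theorem Quiet.lv_eq_zero (h : Quiet E r i c) : lv E (uncovered E r i) c = 0 :=
  h _ (lv_mem_seen 2 c)

theorem Quiet.lv_eq_zero_of_nbr (h : Quiet E r i c) {d : ℕ} (hd : Nbr E c d) :
    lv E (uncovered E r i) d = 0 :=
  h _ (Or.inr ⟨d, hd, lv_mem_seen 1 d⟩)

theorem Quiet.seen_eq (h : Quiet E r i c) {k : ℕ} (hk : k ≤ 2) :
    seen E (uncovered E r i) k c = {0} := by
  refine Set.eq_singleton_iff_unique_mem.2 ⟨?_, fun l hl => h l ?_⟩
  · rw [← h.lv_eq_zero]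
    exact lv_mem_seen k c
  · interval_cases k
    · exact seen_subset_seen_succ 1 c (seen_subset_seen_succ 0 c hl)
    · exact seen_subset_seen_succ 1 c hl
    · exact hl

theorem lv_eq_zero_succ {d : ℕ} (h : lv E (uncovered E r i) d = 0) :
    lv E (uncovered E r (i + 1)) d = 0 := by
  by_contra hne
  have := (lv_pos.1 (Nat.pos_of_ne_zero hne)).mono
    (spanPairs_mono (uncovered_succ_subset (E := E) (r := r) i) d)
  exact (lv_pos.2 this).ne' h

theorem quiet_iff : Quiet E r i c ↔
    lv E (uncovered E r i) c = 0 ∧ (∀ d, Nbr E c d → lv E (uncovered E r i) d = 0) ∧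
      ∀ d a, Nbr E c d → Nbr E d a → lv E (uncovered E r i) a = 0 := by
  constructor
  · exact fun h => ⟨h.lv_eq_zero, fun d => h.lv_eq_zero_of_nbr,
      fun d a h1 h2 => h _ (lv_mem_seen_two h1 h2)⟩
  · rintro ⟨h0, h1, h2⟩ l ((rfl | ⟨d, hd, rfl⟩) | ⟨d, hd, rfl | ⟨a, ha, rfl⟩⟩)
    · exact h0
    · exact h1 d hd
    · exact h1 d hd
    · exact h2 d a hd ha

theorem Quiet.succ (h : Quiet E r i c) : Quiet E r (i + 1) c := by
  rw [quiet_iff] at h ⊢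
  exact ⟨lv_eq_zero_succ h.1, fun d hd => lv_eq_zero_succ (h.2.1 d hd),
    fun d a hd ha => lv_eq_zero_succ (h.2.2 d a hd ha)⟩

theorem Quiet.not_isCand (h : Quiet E r i c) : ¬ IsCand E (uncovered E r i) c :=
  fun hc => hc.1.ne' h.lv_eq_zero

theorem Quiet.not_votes (h : Quiet E r i c) (b d : ℕ) :
    ¬ Votes E (uncovered E r i) (r i) (c, b) d := fun hv =>
  hv.1.1.ne' (h.lv_eq_zero_of_nbr (Or.inl (mem_of_mem_star hv.2.1).2.1))

theorem Quiet.selected_succ (h : Quiet E r i c) : selected E r (i + 1) c = selected E r i c := by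
  rw [selected, if_neg fun ha => h.not_isCand ha.1, Finset.union_empty]

theorem Quiet.mem_uncovered_succ (h : Quiet E r i c) (b : ℕ) :
    (c, b) ∈ uncovered E r (i + 1) ↔ (c, b) ∈ uncovered E r i := by
  rw [uncovered, mem_residual, and_iff_left]
  rintro ⟨d, hd, hmem⟩
  exact hd.1.1.ne' (h.lv_eq_zero_of_nbr (Or.inl (mem_of_mem_star hmem).2.1))

/-- The memory of a halted vertex never changes, and this does no harm: there are no candidates
among its neighbours any more, so that in the covering process nothing changes at this vertex
either. -/
theorem Halted.succ {σ : Memory} (h : Halted E r N i c σ) : Halted E r N (i + 1) c σ where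
  quiet := h.quiet.succ
  inp := h.inp
  unc := by simp only [h.unc, h.quiet.mem_uncovered_succ]
  sel := by rw [h.sel, h.quiet.selected_succ]
  lvl := h.lvl
  star := h.star
  seen := h.seen
  cand := h.cand
  vote := h.vote
  acc := h.acc
  out := by
    rw [h.out, h.quiet.selected_succ]
    congr 2
    ext ⟨a, b⟩
    constructor
    · rintro ⟨rfl, h1⟩
      exact ⟨rfl, (h.quiet.mem_uncovered_succ b).2 h1⟩
    · rintro ⟨rfl, h1⟩
      exact ⟨rfl, (h.quiet.mem_uncovered_succ b).1 h1⟩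

theorem Halted.agrees {σ : Memory} (h : Halted E r N i c σ) (j : ℕ) : Agrees E r N i j c σ where
  inp := h.inp
  unc := h.unc
  sel_old _ := h.sel
  sel_new _ := by rw [h.sel, h.quiet.selected_succ]
  lvl _ := by rw [h.lvl, h.quiet.lv_eq_zero]
  star _ := by rw [h.star, star_eq_empty_of_lv_eq_zero h.quiet.lv_eq_zero]
  seen _ := by rw [h.seen, h.quiet.seen_eq (min_le_right _ _)]
  cand _ := iff_of_false h.cand h.quiet.not_isCand
  rank _ hc := absurd hc h.quiet.not_isCand
  vote _ b d := by
    rw [h.vote]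
    exact iff_of_false (Set.notMem_empty _) (h.quiet.not_votes b d)
  acc _ := iff_of_false h.acc fun ha => h.quiet.not_isCand ha.1

variable {σ : Memory} {x : ℕ} {I : Set (ℕ × Memory)}

theorem union_seen_eq {U : Finset (ℕ × ℕ)} {k : ℕ}
    (hI : ∀ d s, (d, s) ∈ I → Nbr E c d ∧ s.seen = seen E U k d)
    (hI' : ∀ d, Nbr E c d → ∃ s, (d, s) ∈ I) :
    seen E U k c ∪ {l | ∃ d s, (d, s) ∈ I ∧ l ∈ s.seen} = seen E U (k + 1) c := by
  rw [seen]
  congr 1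
  ext l
  constructor
  · rintro ⟨d, s, hs, hl⟩
    obtain ⟨h1, h2⟩ := hI d s hs
    exact ⟨d, h1, h2 ▸ hl⟩
  · rintro ⟨d, hd, hl⟩
    obtain ⟨s, hs⟩ := hI' d hd
    exact ⟨d, s, hs, by rw [(hI d s hs).2]; exact hl⟩

theorem Agrees.round_zero (h : Agrees E r N i 0 c σ) (hclock : σ.clock = 0)
    (hI : ∀ d s, (d, s) ∈ I → Nbr E c d ∧ Agrees E r N i 0 d s)
    (hI' : ∀ d, Nbr E c d → ∃ s, (d, s) ∈ I) : Agrees E r N i 1 c (round σ x I) := by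
  have hP : toFin {e : ℕ × ℕ | e.1 ∈ σ.inp.inNbrs ∧ e.2 ∈ σ.inp.outNbrs ∧
      ∃ s, (e.1, s) ∈ I ∧ e.2 ∈ s.unc} = spanPairs E (uncovered E r i) c := by
    rw [← toFin_coe (spanPairs E (uncovered E r i) c)]
    congr 1
    ext e
    simp only [h.inp, inputOf, Set.mem_ofPred_eq, Finset.mem_coe, mem_spanPairs]
    constructor
    · rintro ⟨h1, h2, s, hs, h3⟩
      rw [(hI _ _ hs).2.unc] at h3
      exact ⟨h3, h1, h2⟩
    · rintro ⟨h1, h2, h3⟩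
      obtain ⟨s, hs⟩ := hI' e.1 (Or.inr h2)
      exact ⟨h2, h3, s, hs, by rw [(hI _ _ hs).2.unc]; exact h1⟩
  rw [round, hclock]
  simp only [hP]
  exact
    { inp := h.inp
      unc := h.unc
      sel_old := fun _ => h.sel_old (by norm_num)
      sel_new := fun hj => absurd hj (by norm_num)
      lvl := fun _ => rfl
      star := fun _ => rfl
      seen := fun _ => rfl
      cand := fun hj => absurd hj (by norm_num)
      rank := fun hj => absurd hj (by norm_num)
      vote := fun hj => absurd hj (by norm_num)
      acc := fun hj => absurd hj (by norm_num) }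

theorem Agrees.round_one (h : Agrees E r N i 1 c σ) (hclock : σ.clock = 1)
    (hI : ∀ d s, (d, s) ∈ I → Nbr E c d ∧ Agrees E r N i 1 d s)
    (hI' : ∀ d, Nbr E c d → ∃ s, (d, s) ∈ I) : Agrees E r N i 2 c (round σ x I) := by
  rw [round, hclock]
  exact
    { inp := h.inp
      unc := h.unc
      sel_old := fun _ => h.sel_old (by norm_num)
      sel_new := fun hj => absurd hj (by norm_num)
      lvl := fun _ => h.lvl le_rfl
      star := fun _ => h.star le_rfl
      seen := fun _ => by
        simp only [h.seen le_rfl]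
        exact union_seen_eq (fun d s hs => ⟨(hI d s hs).1, (hI d s hs).2.seen le_rfl⟩) hI'
      cand := fun hj => absurd hj (by norm_num)
      rank := fun hj => absurd hj (by norm_num)
      vote := fun hj => absurd hj (by norm_num)
      acc := fun hj => absurd hj (by norm_num) }

theorem Agrees.round_two (h : Agrees E r N i 2 c σ) (hclock : σ.clock = 2) (hx : x = r i c)
    (hI : ∀ d s, (d, s) ∈ I → Nbr E c d ∧ Agrees E r N i 2 d s)
    (hI' : ∀ d, Nbr E c d → ∃ s, (d, s) ∈ I) : Agrees E r N i 3 c (round σ x I) := by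
  have hseen : σ.seen ∪ {l | ∃ d s, (d, s) ∈ I ∧ l ∈ s.seen} =
      TwoSpanner.seen E (uncovered E r i) 2 c := by
    rw [h.seen (by norm_num)]
    exact union_seen_eq (fun d s hs => ⟨(hI d s hs).1, (hI d s hs).2.seen (by norm_num)⟩) hI'
  rw [round, hclock]
  simp only [hseen]
  exact
    { inp := h.inp
      unc := h.unc
      sel_old := fun _ => h.sel_old (by norm_num)
      sel_new := fun hj => absurd hj (by norm_num)
      lvl := fun _ => h.lvl (by norm_num)
      star := fun _ => h.star (by norm_num)
      seen := fun _ => rfl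
      cand := fun _ => by
        simp only [h.lvl (by norm_num), IsCand]
      rank := fun _ _ => hx
      vote := fun hj => absurd hj (by norm_num)
      acc := fun hj => absurd hj (by norm_num) }

theorem Agrees.round_three (h : Agrees E r N i 3 c σ) (hclock : σ.clock = 3)
    (hI : ∀ d s, (d, s) ∈ I → Nbr E c d ∧ Agrees E r N i 3 d s)
    (hI' : ∀ d, Nbr E c d → ∃ s, (d, s) ∈ I) : Agrees E r N i 4 c (round σ x I) := by
  have hself : σ.inp.self = c := by rw [h.inp]; rfl
  rw [round, hclock]
  exact
    { inp := h.inp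
      unc := h.unc
      sel_old := fun _ => h.sel_old (by norm_num)
      sel_new := fun hj => absurd hj (by norm_num)
      lvl := fun _ => h.lvl (by norm_num)
      star := fun _ => h.star (by norm_num)
      seen := fun _ => h.seen (by norm_num)
      cand := fun _ => h.cand le_rfl
      rank := fun _ => h.rank le_rfl
      vote := fun _ b d => by
        simp only [hself, h.unc, Set.mem_ofPred_eq]
        constructor
        · rintro ⟨-, s, hs, h1, h2, h3⟩
          have hd := (hI d s hs).2
          have hcand := (hd.cand le_rfl).1 h1
          rw [hd.star (by norm_num)] at h2
          refine ⟨hcand, h2, fun c' hc' hmem => ?_⟩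
          obtain ⟨s', hs'⟩ := hI' c' (Or.inl (mem_of_mem_star hmem).2.1)
          have hd' := (hI c' s' hs').2
          have := h3 c' s' hs' ((hd'.cand le_rfl).2 hc')
            (by rw [hd'.star (by norm_num)]; exact hmem)
          rwa [hd.rank le_rfl hcand, hd'.rank le_rfl hc'] at this
        · rintro ⟨h1, h2, h3⟩
          obtain ⟨s, hs⟩ := hI' d (Or.inl (mem_of_mem_star h2).2.1)
          have hd := (hI d s hs).2
          refine ⟨(mem_of_mem_star h2).1, s, hs, (hd.cand le_rfl).2 h1,
            by rw [hd.star (by norm_num)]; exact h2, fun c' s' hs' hcand hmem => ?_⟩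
          have hd' := (hI c' s' hs').2
          rw [hd'.cand le_rfl] at hcand
          rw [hd'.star (by norm_num)] at hmem
          rw [hd.rank le_rfl h1, hd'.rank le_rfl hcand]
          exact h3 c' hcand hmem
      acc := fun hj => absurd hj (by norm_num) }

theorem Agrees.round_four (h : Agrees E r N i 4 c σ) (hclock : σ.clock = 4)
    (hI : ∀ d s, (d, s) ∈ I → Nbr E c d ∧ Agrees E r N i 4 d s)
    (hI' : ∀ d, Nbr E c d → ∃ s, (d, s) ∈ I) : Agrees E r N i 5 c (round σ x I) := by
  classical
  have hself : σ.inp.self = c := by rw [h.inp]; rfl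
  have hacc : (σ.cand ∧ σ.star.card ≤
      8 * (σ.star.filter fun e => ∃ s, (e.1, s) ∈ I ∧ (e.2, σ.inp.self) ∈ s.vote).card) =
      Accepted E (uncovered E r i) (r i) c := by
    have hfilter : (σ.star.filter fun e => ∃ s, (e.1, s) ∈ I ∧ (e.2, c) ∈ s.vote) =
        σ.star.filter fun e => Votes E (uncovered E r i) (r i) e c := by
      refine Finset.filter_congr fun e he => ?_
      rw [h.star (by norm_num)] at he
      constructor
      · rintro ⟨s, hs, hv⟩
        exact ((hI e.1 s hs).2.vote le_rfl e.2 c).1 hv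
      · intro hv
        obtain ⟨s, hs⟩ := hI' e.1 (Or.inr (mem_of_mem_star he).2.1)
        exact ⟨s, hs, ((hI e.1 s hs).2.vote le_rfl e.2 c).2 hv⟩
    rw [Accepted, ← h.cand (by norm_num), ← h.star (by norm_num), hself, hfilter]
  rw [round, hclock]
  simp only [hacc]
  exact
    { inp := h.inp
      unc := h.unc
      sel_old := fun hj => absurd hj (by norm_num)
      sel_new := fun _ => by
        simp only [h.sel_old le_rfl, hself, h.star (show 1 ≤ 4 by norm_num), selected]
        split_ifs <;> simp
      lvl := fun _ => h.lvl (by norm_num)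
      star := fun _ => h.star (by norm_num)
      seen := fun _ => h.seen (by norm_num)
      cand := fun _ => h.cand (by norm_num)
      rank := fun _ => h.rank (by norm_num)
      vote := fun _ => h.vote le_rfl
      acc := fun _ => Iff.rfl }

theorem Agrees.round_five (h : Agrees E r N i 5 c σ) (hclock : σ.clock = 5)
    (hI : ∀ d s, (d, s) ∈ I → Nbr E c d ∧ Agrees E r N i 5 d s)
    (hI' : ∀ d, Nbr E c d → ∃ s, (d, s) ∈ I) :
    Agrees E r N (i + 1) 0 c (round σ x I) ∧
      (¬ Quiet E r i c → (round σ x I).out = none) ∧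
      (Quiet E r i c → Halted E r N (i + 1) c (round σ x I)) := by
  have hself : σ.inp.self = c := by rw [h.inp]; rfl
  have hseen : (∀ l ∈ σ.seen, l = 0) ↔ Quiet E r i c := by
    rw [h.seen (by norm_num)]
    rfl
  have hunc : σ.unc \ {b | ∃ c s, (c, s) ∈ I ∧ s.acc ∧ (σ.inp.self, b) ∈ s.star} =
      {b | (c, b) ∈ uncovered E r (i + 1)} := by
    ext b
    rw [hself, h.unc]
    simp only [uncovered, mem_residual, Set.mem_sdiff, Set.mem_ofPred_eq]
    refine and_congr_right fun _ => not_congr ⟨?_, ?_⟩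
    · rintro ⟨d, s, hs, h1, h2⟩
      have hd := (hI d s hs).2
      exact ⟨d, (hd.acc le_rfl).1 h1, hd.star (by norm_num) ▸ h2⟩
    · rintro ⟨d, h1, h2⟩
      obtain ⟨s, hs⟩ := hI' d (Or.inl (mem_of_mem_star h2).2.1)
      have hd := (hI d s hs).2
      exact ⟨d, s, hs, (hd.acc le_rfl).2 h1, by rw [hd.star (by norm_num)]; exact h2⟩
  rw [round, hclock]
  simp only [hunc]
  refine ⟨?_, fun hq => if_neg fun h0 => hq (hseen.1 h0), fun hq => ?_⟩
  · exact
    { inp := h.inp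
      unc := rfl
      sel_old := fun _ => h.sel_new le_rfl
      sel_new := fun hj => absurd hj (by norm_num)
      lvl := fun hj => absurd hj (by norm_num)
      star := fun hj => absurd hj (by norm_num)
      seen := fun hj => absurd hj (by norm_num)
      cand := fun hj => absurd hj (by norm_num)
      rank := fun hj => absurd hj (by norm_num)
      vote := fun hj => absurd hj (by norm_num)
      acc := fun hj => absurd hj (by norm_num) }
  · exact
    { quiet := hq.succ
      inp := h.inp
      unc := rfl
      sel := h.sel_new le_rfl
      lvl := (h.lvl (by norm_num)).trans hq.lv_eq_zero
      star := (h.star (by norm_num)).trans (star_eq_empty_of_lv_eq_zero hq.lv_eq_zero)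
      seen := (h.seen (by norm_num)).trans (hq.seen_eq le_rfl)
      cand := fun hc => hq.not_isCand ((h.cand (by norm_num)).1 hc)
      vote := Set.eq_empty_of_forall_notMem fun p hp =>
        hq.not_votes p.1 p.2 ((h.vote (by norm_num) p.1 p.2).1 hp)
      acc := fun ha => hq.not_isCand ((h.acc le_rfl).1 ha).1
      out := by
        simp only [if_pos (hseen.2 hq), hself, h.sel_new le_rfl]
        congr 2
        ext ⟨a, b⟩
        constructor
        · rintro ⟨rfl, h1⟩
          exact ⟨rfl, h1⟩
        · rintro ⟨rfl, h1⟩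
          exact ⟨rfl, h1⟩ }

theorem out_round_of_clock (hclock : σ.clock ≤ 4) :
    (round σ x I).out = σ.out ∧ (round σ x I).clock = σ.clock + 1 := by
  rw [round]
  have h : σ.clock = 0 ∨ σ.clock = 1 ∨ σ.clock = 2 ∨ σ.clock = 3 ∨ σ.clock = 4 := by omega
  rcases h with h | h | h | h | h <;> rw [h] <;> exact ⟨rfl, rfl⟩

theorem clock_round_five (hclock : σ.clock = 5) : (round σ x I).clock = 0 := by
  rw [round, hclock]
  rfl

end Algorithm

/-! ### Executions -/

section Execution

variable {V : Type} {Γ : Network V}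

theorem link_adj {u v : V} : Γ.link.Adj u v ↔ Γ.graph.Adj u v ∨ Γ.graph.Adj v u := by
  rw [Network.link, Digraph.toSimpleGraphInclusive, SimpleGraph.fromRel_adj, and_iff_right_iff_imp]
  rintro (h | h) rfl <;> exact Γ.loopless _ h

variable {N : ℕ}

/-- The ranks used in an execution. The rank for a phase is drawn in its third round. -/
noncomputable def ranks (Γ : Network V) (ω : alg.Coins N V) (i : ℕ) : ℕ → ℕ :=
  rankOf Γ.ident fun v => ω (6 * i + 2, v)

theorem ranks_ident (ω : alg.Coins N V) (i : ℕ) (v : V) :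
    ranks Γ ω i (Γ.ident v) = ω (6 * i + 2, v) := by
  rw [ranks, rankOf, Γ.ident_injective.extend_apply]

theorem run_succ_of_out_eq_none {ω : alg.Coins N V} {t : ℕ} {v : V}
    (h : (alg.run Γ N ω t v).out = none) :
    alg.run Γ N ω (t + 1) v =
      round (alg.run Γ N ω t v) (ω (t, v)) (alg.inbox Γ (alg.run Γ N ω t) v) := by
  have h' : ¬ (alg.output (alg.run Γ N ω t v)).isSome = true := by
    rw [show alg.output (alg.run Γ N ω t v) = none from h]
    simp
  exact if_neg h'

theorem run_succ_of_out_eq_some {ω : alg.Coins N V} {t : ℕ} {v : V} {F : Set (ℕ × ℕ)}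
    (h : (alg.run Γ N ω t v).out = some F) :
    alg.run Γ N ω (t + 1) v = alg.run Γ N ω t v := by
  have h' : (alg.output (alg.run Γ N ω t v)).isSome = true := by
    rw [show alg.output (alg.run Γ N ω t v) = some F from h]
    rfl
  exact if_pos h'

variable [Fintype V]

variable (Γ) in
/-- The edges of the network, in terms of identifiers. -/
noncomputable def edgeIds : Finset (ℕ × ℕ) :=
  (Set.toFinite (Prod.map Γ.ident Γ.ident '' Γ.graph.edges)).toFinset

theorem ident_mem_edgeIds {u w : V} : (Γ.ident u, Γ.ident w) ∈ edgeIds Γ ↔ Γ.graph.Adj u w := by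
  rw [edgeIds, Set.Finite.mem_toFinset]
  exact (Γ.ident_injective.prodMap Γ.ident_injective).mem_set_image (a := (u, w))

theorem exists_of_mem_edgeIds {p : ℕ × ℕ} (h : p ∈ edgeIds Γ) :
    ∃ u w, Γ.graph.Adj u w ∧ p = (Γ.ident u, Γ.ident w) := by
  rw [edgeIds, Set.Finite.mem_toFinset] at h
  obtain ⟨⟨u, w⟩, h1, rfl⟩ := h
  exact ⟨u, w, h1, rfl⟩

theorem card_edgeIds : (edgeIds Γ).card = Γ.numEdges := by
  rw [edgeIds, ← Set.ncard_eq_toFinset_card _ (Set.toFinite _), Set.ncard_image_of_injective _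
    (Γ.ident_injective.prodMap Γ.ident_injective)]
  rfl

theorem exists_ident_of_mem_verts {c : ℕ} (h : c ∈ verts (edgeIds Γ)) : ∃ v, Γ.ident v = c := by
  rcases Finset.mem_union.1 h with h | h <;> obtain ⟨p, hp, rfl⟩ := Finset.mem_image.1 h <;>
    obtain ⟨u, w, -, rfl⟩ := exists_of_mem_edgeIds hp
  · exact ⟨u, rfl⟩
  · exact ⟨w, rfl⟩

theorem nbr_iff_link_adj {u v : V} :
    Nbr (edgeIds Γ) (Γ.ident u) (Γ.ident v) ↔ Γ.link.Adj u v := by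
  rw [Nbr, ident_mem_edgeIds, ident_mem_edgeIds, link_adj]

theorem localInput_eq (N : ℕ) (v : V) :
    LocalAlg.localInput Γ N v = inputOf (edgeIds Γ) N (Γ.ident v) := by
  have h1 : {i | ∃ u, Γ.graph.Adj v u ∧ Γ.ident u = i} = {b | (Γ.ident v, b) ∈ edgeIds Γ} := by
    ext b
    constructor
    · rintro ⟨u, hu, rfl⟩
      exact ident_mem_edgeIds.2 hu
    · intro h
      obtain ⟨u, w, huw, heq⟩ := exists_of_mem_edgeIds h
      obtain ⟨h1, rfl⟩ := Prod.mk.injEq .. ▸ heq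
      obtain rfl := Γ.ident_injective h1
      exact ⟨w, huw, rfl⟩
  have h2 : {i | ∃ u, Γ.graph.Adj u v ∧ Γ.ident u = i} = {a | (a, Γ.ident v) ∈ edgeIds Γ} := by
    ext a
    constructor
    · rintro ⟨u, hu, rfl⟩
      exact ident_mem_edgeIds.2 hu
    · intro h
      obtain ⟨u, w, huw, heq⟩ := exists_of_mem_edgeIds h
      obtain ⟨rfl, h1⟩ := Prod.mk.injEq .. ▸ heq
      obtain rfl := Γ.ident_injective h1
      exact ⟨u, huw, rfl⟩
  simp only [LocalAlg.localInput, inputOf, h1, h2]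

variable (Γ) in
/-- In the round `j` of the phase `i`, every vertex is in step with the covering process or has
halted. -/
def InStep (ω : alg.Coins N V) (i j : ℕ) (v : V) : Prop :=
  (Agrees (edgeIds Γ) (ranks Γ ω) N i j (Γ.ident v) (alg.run Γ N ω (6 * i + j) v) ∧
    (alg.run Γ N ω (6 * i + j) v).clock = j ∧ (alg.run Γ N ω (6 * i + j) v).out = none) ∨
  Halted (edgeIds Γ) (ranks Γ ω) N i (Γ.ident v) (alg.run Γ N ω (6 * i + j) v)

theorem inbox_agrees {ω : alg.Coins N V} {i j : ℕ} (h : ∀ v, InStep Γ ω i j v) (v : V) :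
    (∀ d s, (d, s) ∈ alg.inbox Γ (alg.run Γ N ω (6 * i + j)) v →
      Nbr (edgeIds Γ) (Γ.ident v) d ∧ Agrees (edgeIds Γ) (ranks Γ ω) N i j d s) ∧
    ∀ d, Nbr (edgeIds Γ) (Γ.ident v) d →
      ∃ s, (d, s) ∈ alg.inbox Γ (alg.run Γ N ω (6 * i + j)) v := by
  constructor
  · rintro d s ⟨u, hu, heq⟩
    obtain ⟨rfl, rfl⟩ := Prod.mk.injEq .. ▸ heq
    exact ⟨nbr_iff_link_adj.2 hu, (h u).elim (fun h => h.1) fun h => h.agrees j⟩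
  · intro d hd
    have hv : d ∈ verts (edgeIds Γ) := by
      rcases hd with hd | hd
      · exact Finset.mem_union_right _ (Finset.mem_image.2 ⟨_, hd, rfl⟩)
      · exact Finset.mem_union_left _ (Finset.mem_image.2 ⟨_, hd, rfl⟩)
    obtain ⟨u, rfl⟩ := exists_ident_of_mem_verts hv
    exact ⟨_, u, nbr_iff_link_adj.1 hd, rfl⟩

theorem inStep_succ {ω : alg.Coins N V} {i j : ℕ} (hj : j ≤ 4) (h : ∀ v, InStep Γ ω i j v)
    (v : V) : InStep Γ ω i (j + 1) v := by
  obtain ⟨hI, hI'⟩ := inbox_agrees h v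
  rcases h v with ⟨ha, hclock, hout⟩ | hhalt
  · left
    rw [← add_assoc, run_succ_of_out_eq_none hout]
    obtain ⟨h1, h2⟩ := out_round_of_clock (σ := alg.run Γ N ω (6 * i + j) v)
      (x := ω (6 * i + j, v)) (I := alg.inbox Γ (alg.run Γ N ω (6 * i + j)) v) (hclock.le.trans hj)
    refine ⟨?_, by rw [h2, hclock], by rw [h1, hout]⟩
    have h5 : j = 0 ∨ j = 1 ∨ j = 2 ∨ j = 3 ∨ j = 4 := by omega
    rcases h5 with rfl | rfl | rfl | rfl | rfl
    · exact ha.round_zero hclock hI hI'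
    · exact ha.round_one hclock hI hI'
    · exact ha.round_two hclock (ranks_ident ω i v).symm hI hI'
    · exact ha.round_three hclock hI hI'
    · exact ha.round_four hclock hI hI'
  · right
    rw [← add_assoc, run_succ_of_out_eq_some hhalt.out]
    exact hhalt

theorem inStep_next_phase {ω : alg.Coins N V} {i : ℕ} (h : ∀ v, InStep Γ ω i 0 v) (v : V) :
    InStep Γ ω (i + 1) 0 v ∧ (Quiet (edgeIds Γ) (ranks Γ ω) i (Γ.ident v) →
      Halted (edgeIds Γ) (ranks Γ ω) N (i + 1) (Γ.ident v)
        (alg.run Γ N ω (6 * (i + 1)) v)) := by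
  have h5 : ∀ v, InStep Γ ω i 5 v :=
    inStep_succ le_rfl <| inStep_succ (by norm_num) <| inStep_succ (by norm_num) <|
      inStep_succ (by norm_num) <| inStep_succ (by norm_num) h
  obtain ⟨hI, hI'⟩ := inbox_agrees h5 v
  have htime : 6 * (i + 1) = 6 * i + 5 + 1 := by ring
  rw [InStep, add_zero, htime]
  rcases h5 v with ⟨ha, hclock, hout⟩ | hhalt
  · rw [run_succ_of_out_eq_none hout]
    obtain ⟨h1, h2, h3⟩ := ha.round_five (x := ω (6 * i + 5, v)) hclock hI hI'
    by_cases hq : Quiet (edgeIds Γ) (ranks Γ ω) i (Γ.ident v)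
    · exact ⟨Or.inr (h3 hq), h3⟩
    · exact ⟨Or.inl ⟨h1, clock_round_five hclock, h2 hq⟩, h3⟩
  · rw [run_succ_of_out_eq_some hhalt.out]
    exact ⟨Or.inr hhalt.succ, fun _ => hhalt.succ⟩

theorem inStep_zero (ω : alg.Coins N V) (i : ℕ) (v : V) : InStep Γ ω i 0 v := by
  induction i generalizing v with
  | zero =>
    left
    refine ⟨?_, rfl, rfl⟩
    exact
    { inp := localInput_eq N v
      unc := by
        change (LocalAlg.localInput Γ N v).outNbrs = _
        rw [localInput_eq]
        rfl
      sel_old := fun _ => by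
        rw [selected, Finset.coe_empty]
        rfl
      sel_new := fun hj => absurd hj (by norm_num)
      lvl := fun hj => absurd hj (by norm_num)
      star := fun hj => absurd hj (by norm_num)
      seen := fun hj => absurd hj (by norm_num)
      cand := fun hj => absurd hj (by norm_num)
      rank := fun hj => absurd hj (by norm_num)
      vote := fun hj => absurd hj (by norm_num)
      acc := fun hj => absurd hj (by norm_num) }
  | succ i ih => exact (inStep_next_phase ih v).1

/-- When the covering process has come to an end, all vertices halt within one more phase. -/
theorem halted_of_forall_lv_eq_zero {ω : alg.Coins N V} {T : ℕ}
    (hT : ∀ c, lv (edgeIds Γ) (uncovered (edgeIds Γ) (ranks Γ ω) T) c = 0) (v : V) :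
    Halted (edgeIds Γ) (ranks Γ ω) N (T + 1) (Γ.ident v) (alg.run Γ N ω (6 * (T + 1)) v) := by
  refine (inStep_next_phase (inStep_zero ω T) v).2 fun l hl => ?_
  obtain ⟨d, rfl⟩ := exists_lv_of_mem_seen hl
  exact hT d

theorem haltsWithin_of_forall_lv_eq_zero {ω : alg.Coins N V} {T : ℕ}
    (hT : ∀ c, lv (edgeIds Γ) (uncovered (edgeIds Γ) (ranks Γ ω) T) c = 0) :
    alg.HaltsWithin Γ N ω (6 * (T + 1)) := fun v => by
  have h : alg.output (alg.run Γ N ω (6 * (T + 1)) v) = _ := (halted_of_forall_lv_eq_zero hT v).out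
  rw [h]
  rfl

theorem outputsIncidentEdges_of_forall_lv_eq_zero {ω : alg.Coins N V} {T : ℕ}
    (hT : ∀ c, lv (edgeIds Γ) (uncovered (edgeIds Γ) (ranks Γ ω) T) c = 0) :
    alg.OutputsIncidentEdges Γ N ω (6 * (T + 1)) := by
  intro v F hF p hp
  have h : alg.output (alg.run Γ N ω (6 * (T + 1)) v) = _ := (halted_of_forall_lv_eq_zero hT v).out
  rw [h, Option.some_inj] at hF
  subst hF
  have key : p ∈ edgeIds Γ ∧ (p.1 = Γ.ident v ∨ p.2 = Γ.ident v) := by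
    rcases hp with hp | ⟨hp1, hp2⟩
    · exact selected_subset _ _ p hp
    · exact ⟨uncovered_subset _ hp2, Or.inl hp1⟩
  obtain ⟨u, w, huw, rfl⟩ := exists_of_mem_edgeIds key.1
  exact ⟨(u, w), huw, key.2.imp (fun h => Γ.ident_injective h) fun h => Γ.ident_injective h, rfl⟩

theorem mem_outputEdges_iff {ω : alg.Coins N V} {T : ℕ}
    (hT : ∀ c, lv (edgeIds Γ) (uncovered (edgeIds Γ) (ranks Γ ω) T) c = 0) {e : V × V} :
    e ∈ alg.outputEdges Γ N ω (6 * (T + 1)) ↔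
      (Γ.ident e.1, Γ.ident e.2) ∈ spanner (edgeIds Γ) (ranks Γ ω) (T + 1) := by
  have h : ∀ v, alg.output (alg.run Γ N ω (6 * (T + 1)) v) = _ :=
    fun v => (halted_of_forall_lv_eq_zero hT v).out
  rw [spanner, Finset.mem_union, Finset.mem_biUnion]
  constructor
  · rintro ⟨v, F, hF, hp⟩
    rw [h, Option.some_inj] at hF
    subst hF
    rcases hp with hp | ⟨hp1, hp2⟩
    · obtain ⟨hpE, hv⟩ := selected_subset _ _ _ hp
      refine Or.inl ⟨_, ?_, hp⟩
      rcases hv with hv | hv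
      · exact Finset.mem_union_left _ (Finset.mem_image.2 ⟨_, hpE, hv⟩)
      · exact Finset.mem_union_right _ (Finset.mem_image.2 ⟨_, hpE, hv⟩)
    · exact Or.inr hp2
  · rintro (⟨c, hc, hp⟩ | hp)
    · obtain ⟨v, rfl⟩ := exists_ident_of_mem_verts hc
      exact ⟨v, _, h v, Or.inl hp⟩
    · exact ⟨e.1, _, h e.1, Or.inr ⟨rfl, hp⟩⟩

end Execution

/-! ### The approximation ratio -/

section Ratio

variable {V : Type}

theorem hasWalk_le_two_iff {S : Set (V × V)} {u w : V} (huw : u ≠ w) :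
    (∃ ℓ ≤ 2, HasWalk S ℓ u w) ↔ (u, w) ∈ S ∨ ∃ x, (u, x) ∈ S ∧ (x, w) ∈ S := by
  constructor
  · rintro ⟨ℓ, hℓ, h⟩
    cases h with
    | nil => exact absurd rfl huw
    | cons h1 h =>
      cases h with
      | nil => exact Or.inl h1
      | cons h2 h =>
        cases h with
        | nil => exact Or.inr ⟨_, h1, h2⟩
        | cons h3 h => omega
  · rintro (h | ⟨x, h1, h2⟩)
    · exact ⟨1, by norm_num, .cons h (.nil w)⟩
    · exact ⟨2, le_rfl, .cons h1 (.cons h2 (.nil w))⟩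

variable [Fintype V] {Γ : Network V}

/-- A spanner is connected, so that it has at least `n - 1` edges. -/
theorem numVertices_le_ncard_add_one {k : ℕ} {S : Set (V × V)}
    (hS : IsDirectedSpanner Γ.graph k S) : Γ.numVertices ≤ S.ncard + 1 := by
  set H : SimpleGraph V := SimpleGraph.fromEdgeSet ((fun e : V × V => s(e.1, e.2)) '' S) with hH
  have hwalk : ∀ {ℓ u w}, HasWalk S ℓ u w → H.Reachable u w := by
    intro ℓ u w h
    induction h with
    | nil u => exact SimpleGraph.Reachable.refl u
    | @cons ℓ u v w huv _ ih =>
      refine SimpleGraph.Reachable.trans ?_ ih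
      by_cases huv' : u = v
      · rw [huv']
      · exact SimpleGraph.Adj.reachable
          ((SimpleGraph.fromEdgeSet_adj _).2 ⟨⟨(u, v), huv, rfl⟩, huv'⟩)
  have hadj : ∀ {u v}, Γ.graph.Adj u v → H.Reachable u v := fun {u v} h => by
    obtain ⟨ℓ, -, hw⟩ := hS.2 u v h
    exact hwalk hw
  have hreach : ∀ {u v}, Γ.link.Reachable u v → H.Reachable u v := by
    rintro u v ⟨p⟩
    induction p with
    | nil => exact SimpleGraph.Reachable.refl _
    | cons h _ ih =>
      refine SimpleGraph.Reachable.trans ?_ ih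
      rcases link_adj.1 h with h | h
      · exact hadj h
      · exact (hadj h).symm
  have hconn : H.Connected :=
    { preconnected := fun u v => hreach (Γ.connected.preconnected u v)
      nonempty := Γ.connected.nonempty }
  have h1 := hconn.card_vert_le_card_edgeSet_add_one
  rw [Nat.card_eq_fintype_card, Nat.card_coe_set_eq] at h1
  refine h1.trans (Nat.add_le_add_right ?_ 1)
  rw [hH, SimpleGraph.edgeSet_fromEdgeSet]
  exact (Set.ncard_le_ncard Set.sdiff_subset (Set.toFinite _)).trans
    (Set.ncard_image_le (Set.toFinite _))

theorem natLog_le_two_mul_max {a : ℝ} (ha : 0 ≤ a) :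
    (Nat.log 2 ⌊a⌋₊ : ℝ) ≤ 2 * max 1 (Real.log a) := by
  by_cases h : ⌊a⌋₊ = 0
  · rw [h, Nat.log_zero_right, Nat.cast_zero]
    positivity
  · have h1 : (2 : ℝ) ^ Nat.log 2 ⌊a⌋₊ ≤ a :=
      le_trans (by exact_mod_cast Nat.pow_log_le_self 2 h) (Nat.floor_le ha)
    have h2 := Real.log_le_log (by positivity) h1
    rw [Real.log_pow] at h2
    have h3 := Real.log_two_gt_d9
    have h4 : (0 : ℝ) ≤ Nat.log 2 ⌊a⌋₊ := Nat.cast_nonneg _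
    have h5 := le_max_right 1 (Real.log a)
    nlinarith

/-- At the end of the covering process, the output is a spanner whose size is within a logarithmic
factor of that of any spanner. -/
theorem isApproxMinDirectedSpanner_preimage {r : ℕ → ℕ → ℕ} {T : ℕ}
    (hT : ∀ c, lv (edgeIds Γ) (uncovered (edgeIds Γ) r T) c = 0) {S : Set (V × V)}
    (hS : ∀ e, e ∈ S ↔ (Γ.ident e.1, Γ.ident e.2) ∈ spanner (edgeIds Γ) r T) :
    IsApproxMinDirectedSpanner Γ.graph 2
      (273 * max 1 (Real.log ((Γ.numEdges : ℝ) / (Γ.numVertices : ℝ)))) S := by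
  have hinj := Γ.ident_injective.prodMap Γ.ident_injective
  have hne : ∀ {u w}, Γ.graph.Adj u w → u ≠ w := fun h heq => Γ.loopless _ (heq ▸ h)
  have hSE : S ⊆ Γ.graph.edges := fun e he =>
    ident_mem_edgeIds.1 (spanner_subset T ((hS e).1 he))
  refine ⟨⟨hSE, fun u w huw => (hasWalk_le_two_iff (hne huw)).2 ?_⟩, fun S' hS' => ?_⟩
  · rcases spanner_spans (r := r) T (ident_mem_edgeIds.2 huw) with h | ⟨c, h1, h2⟩
    · exact Or.inl ((hS _).2 h)
    · obtain ⟨_, x, _, heq⟩ := exists_of_mem_edgeIds (spanner_subset T h1)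
      obtain ⟨-, rfl⟩ := Prod.mk.injEq .. ▸ heq
      exact Or.inr ⟨x, (hS _).2 h1, (hS _).2 h2⟩
  set H : Finset (ℕ × ℕ) := (Set.toFinite (Prod.map Γ.ident Γ.ident '' S')).toFinset with hH
  have hHcard : H.card = S'.ncard := by
    rw [hH, ← Set.ncard_eq_toFinset_card _ (Set.toFinite _), Set.ncard_image_of_injective _ hinj]
  have hmemH : ∀ {u w}, (u, w) ∈ S' → (Γ.ident u, Γ.ident w) ∈ H := fun {u w} h => by
    rw [hH, Set.Finite.mem_toFinset]
    exact ⟨(u, w), h, rfl⟩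
  have hHE : H ⊆ edgeIds Γ := fun p hp => by
    rw [hH, Set.Finite.mem_toFinset] at hp
    obtain ⟨e, he, rfl⟩ := hp
    exact ident_mem_edgeIds.2 (hS'.1 he)
  have hspan : ∀ e ∈ edgeIds Γ, e ∈ H ∨ ∃ x, (e.1, x) ∈ H ∧ (x, e.2) ∈ H := fun e he => by
    obtain ⟨u, w, huw, rfl⟩ := exists_of_mem_edgeIds he
    rcases (hasWalk_le_two_iff (hne huw)).1 (hS'.2 u w huw) with h | ⟨x, h1, h2⟩
    · exact Or.inl (hmemH h)
    · exact Or.inr ⟨_, hmemH h1, hmemH h2⟩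
  have hScard : S.ncard ≤ (spanner (edgeIds Γ) r T).card := by
    rw [← Set.ncard_image_of_injective S hinj, ← Set.ncard_coe_finset]
    refine Set.ncard_le_ncard ?_ (Finset.finite_toSet _)
    rintro _ ⟨e, he, rfl⟩
    exact (hS e).1 he
  have hn0 : 0 < Γ.numVertices := by
    have := Γ.connected.nonempty
    exact Fintype.card_pos
  set a : ℝ := (Γ.numEdges : ℝ) / Γ.numVertices with ha
  set X : ℝ := max 1 (Real.log a) with hX
  have hX1 : 1 ≤ X := le_max_left _ _
  rcases Nat.eq_zero_or_pos S'.ncard with h0 | hpos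
  · -- a spanner without edges spans only the graph without edges
    have hE0 : S = ∅ := Set.eq_empty_of_forall_notMem fun e he => by
      have hS'0 : S' = ∅ := (Set.ncard_eq_zero (Set.toFinite _)).1 h0
      have h1 := (hasWalk_le_two_iff (hne (hSE he))).1 (hS'.2 e.1 e.2 (hSE he))
      simp [hS'0] at h1
    rw [hE0, Set.ncard_empty, Nat.cast_zero]
    positivity
  have ha0 : 0 ≤ a := by positivity
  have hcost := card_spanner_le hT (Nat.log 2 ⌊a⌋₊ + 1) hHE hspan
  rw [hHcard, card_edgeIds] at hcost
  have hpow : a ≤ 2 ^ (Nat.log 2 ⌊a⌋₊ + 1) := by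
    have h1 : ⌊a⌋₊ + 1 ≤ 2 ^ (Nat.log 2 ⌊a⌋₊ + 1) := Nat.lt_pow_succ_log_self (by norm_num) _
    have h2 : ((⌊a⌋₊ : ℝ) + 1) ≤ 2 ^ (Nat.log 2 ⌊a⌋₊ + 1) := by exact_mod_cast h1
    exact (Nat.lt_floor_add_one a).le.trans h2
  have hm : 32 * (Γ.numEdges : ℝ) / 2 ^ (Nat.log 2 ⌊a⌋₊ + 1) ≤ 64 * S'.ncard := by
    have h1 : (Γ.numVertices : ℝ) ≤ 2 * S'.ncard := by
      have h2 := numVertices_le_ncard_add_one hS'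
      have h3 : Γ.numVertices ≤ 2 * S'.ncard := by omega
      exact_mod_cast h3
    rw [div_le_iff₀ (by positivity)]
    have h4 : (Γ.numEdges : ℝ) = a * Γ.numVertices := by
      rw [ha, div_mul_cancel₀ _ (by positivity)]
    rw [h4]
    calc 32 * (a * Γ.numVertices) ≤ 32 * (2 ^ (Nat.log 2 ⌊a⌋₊ + 1) * (2 * S'.ncard)) := by gcongr
      _ = 64 * S'.ncard * 2 ^ (Nat.log 2 ⌊a⌋₊ + 1) := by ring
  have hJ := natLog_le_two_mul_max ha0
  rw [← hX] at hJ
  push_cast at hcost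
  have hfin : (17 + 64 * ((Nat.log 2 ⌊a⌋₊ : ℝ) + 1)) * S'.ncard ≤ (81 + 128 * X) * S'.ncard :=
    mul_le_mul_of_nonneg_right (by linarith) (Nat.cast_nonneg _)
  have h64 : 145 * (S'.ncard : ℝ) ≤ 145 * X * S'.ncard :=
    mul_le_mul_of_nonneg_right (by linarith) (Nat.cast_nonneg _)
  have hScard' : (S.ncard : ℝ) ≤ (spanner (edgeIds Γ) r T).card := by exact_mod_cast hScard
  linarith

end Ratio

/-! ### The number of rounds -/

section Rounds

variable {V : Type} [Fintype V] {Γ : Network V}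

theorem ncard_neighborSet_le_maxDegree (v : V) : (Γ.link.neighborSet v).ncard ≤ Γ.maxDegree :=
  Finset.le_sup (f := fun v => (Γ.link.neighborSet v).ncard) (Finset.mem_univ v)

/-- A dense core contains a vertex of high degree, so that there are few density levels. -/
theorem lv_le_log_maxDegree {U : Finset (ℕ × ℕ)} (hU : U ⊆ edgeIds Γ) (c : ℕ) :
    lv (edgeIds Γ) U c ≤ Nat.log 2 (2 * Γ.maxDegree) := by
  rcases Nat.eq_zero_or_pos (lv (edgeIds Γ) U c) with h0 | hpos
  · rw [h0]
    exact Nat.zero_le _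
  obtain ⟨e, he⟩ := star_nonempty hpos
  obtain ⟨u, w, huw, rfl⟩ := exists_of_mem_edgeIds (hU (mem_of_mem_star he).1)
  have h1 := (isDense_core _ _ _ he).1
  have h2 : ((star (edgeIds Γ) U c).filter fun f => f.1 = Γ.ident u).card ≤ Γ.maxDegree := by
    refine le_trans ?_ (ncard_neighborSet_le_maxDegree u)
    rw [← Set.ncard_image_of_injective (Γ.link.neighborSet u)
      (f := fun v => (Γ.ident u, Γ.ident v))
      fun v v' h => Γ.ident_injective (Prod.mk.inj h).2, ← Set.ncard_coe_finset]
    refine Set.ncard_le_ncard (fun f hf => ?_) (Set.toFinite _)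
    obtain ⟨hf1, hf2⟩ := Finset.mem_filter.1 (Finset.mem_coe.1 hf)
    obtain ⟨u', w', huw', rfl⟩ := exists_of_mem_edgeIds (hU (mem_of_mem_star hf1).1)
    obtain rfl := Γ.ident_injective hf2
    exact ⟨w', link_adj.2 (Or.inl huw'), rfl⟩
  have hΔ : 0 < Γ.maxDegree := by
    have h3 : 0 < ((star (edgeIds Γ) U c).filter fun f => f.1 = Γ.ident u).card :=
      Finset.card_pos.2 ⟨_, Finset.mem_filter.2 ⟨he, rfl⟩⟩
    omega
  exact Nat.le_log_of_pow_le (by norm_num) (h1.trans (Nat.mul_le_mul_left 2 h2))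

theorem numEdges_le : Γ.numEdges ≤ Γ.numVertices ^ 2 := by
  rw [Network.numEdges, Network.numVertices, sq, ← Fintype.card_prod, ← Nat.card_eq_fintype_card,
    ← Set.ncard_univ]
  exact Set.ncard_le_ncard (Set.subset_univ _) (Set.toFinite _)

theorem two_le_maxDegree (h : 3 ≤ Γ.numVertices) : 2 ≤ Γ.maxDegree := by
  classical
  by_contra hlt
  have h1 := Γ.connected.card_vert_le_card_edgeSet_add_one
  have h2 := Γ.link.sum_degrees_eq_twice_card_edges
  have h3 : ∑ v, Γ.link.degree v ≤ ∑ _v : V, 1 := Finset.sum_le_sum fun v _ => by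
    have h4 := ncard_neighborSet_le_maxDegree (Γ := Γ) v
    rw [Set.ncard_eq_toFinset_card', ← SimpleGraph.neighborFinset_def,
      SimpleGraph.card_neighborFinset_eq_degree] at h4
    omega
  rw [Finset.sum_const, smul_eq_mul, mul_one, Finset.card_univ] at h3
  have h5 : Nat.card Γ.graph.toSimpleGraphInclusive.edgeSet = Γ.link.edgeFinset.card := by
    rw [Nat.card_coe_set_eq, Set.ncard_eq_toFinset_card']
    rfl
  rw [Nat.card_eq_fintype_card, h5] at h1
  rw [Network.numVertices] at h
  omega

theorem numVertices_pos : 0 < Γ.numVertices := by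
  have := Γ.connected.nonempty
  exact Fintype.card_pos

theorem log_mul_levels_le (hn : 2 ≤ Γ.numVertices) :
    Real.log Γ.numVertices * (Nat.log 2 (2 * Γ.maxDegree) + 1) ≤
      6 * max 1 (Real.log Γ.numVertices * Real.log Γ.maxDegree) ∧
    Real.log Γ.numVertices ≤ 2 * max 1 (Real.log Γ.numVertices * Real.log Γ.maxDegree) := by
  set n := Γ.numVertices with hn'
  set Δ := Γ.maxDegree with hΔ
  set X := max 1 (Real.log n * Real.log Δ) with hX
  have hX1 : 1 ≤ X := le_max_left _ _
  have hX2 : Real.log n * Real.log Δ ≤ X := le_max_right _ _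
  have hlog2 := Real.log_two_gt_d9
  have hlogn : 0 ≤ Real.log n := Real.log_natCast_nonneg n
  have hlogΔ : 0 ≤ Real.log Δ := Real.log_natCast_nonneg Δ
  have h1 : Real.log n ≤ 2 * X := by
    rcases hn.eq_or_lt with h | h
    · rw [← h]
      have := Real.log_two_lt_d9
      push_cast
      linarith
    · have h2 : Real.log 2 ≤ Real.log Δ :=
        Real.log_le_log (by norm_num) (by exact_mod_cast two_le_maxDegree h)
      have h3 := mul_le_mul_of_nonneg_left (hlog2.le.trans h2) hlogn
      linarith
  refine ⟨?_, h1⟩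
  have h2 : Real.log n * Nat.log 2 (2 * Δ) ≤ 4 * X := by
    rcases Nat.eq_zero_or_pos Δ with h0 | hpos
    · rw [h0, mul_zero, Nat.log_zero_right, Nat.cast_zero, mul_zero]
      linarith
    · have h3 : (2 : ℝ) ^ Nat.log 2 (2 * Δ) ≤ 2 * Δ := by
        exact_mod_cast Nat.pow_log_le_self 2 (by omega)
      have h4 := Real.log_le_log (by positivity) h3
      rw [Real.log_pow, Real.log_mul (by norm_num) (by positivity)] at h4
      have h5 : (Nat.log 2 (2 * Δ) : ℝ) ≤ 1 + 2 * Real.log Δ := by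
        by_contra hlt
        push Not at hlt
        have := mul_lt_mul_of_pos_right hlt (show (0 : ℝ) < Real.log 2 by linarith)
        nlinarith
      have h6 := mul_le_mul_of_nonneg_left h5 hlogn
      linarith
  linarith

/-- The bound for the failure probability, with the base `8 * n ^ 3 + 1` of the potential, after
sufficiently many phases. -/
theorem tail_le {n : ℕ} (hn : 2 ≤ n) (c Λ : ℕ) {T : ℕ}
    (hT : 8 * ((7 * (Λ + 1) + c) * Real.log n) ≤ T) :
    (7 / 8 : ℝ) ^ T * (8 * (n : ℝ) ^ 3 + 1) ^ (Λ + 1) ≤ 1 / (n : ℝ) ^ c := by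
  have hn2 : (2 : ℝ) ≤ n := by exact_mod_cast hn
  have hn0 : (0 : ℝ) < n := by linarith
  have h1 : 8 * (n : ℝ) ^ 3 + 1 ≤ (n : ℝ) ^ 7 := by
    have h2 : (2 : ℝ) ^ 4 ≤ (n : ℝ) ^ 4 := by gcongr
    have h3 : (1 : ℝ) ≤ (n : ℝ) ^ 3 := one_le_pow₀ (by linarith)
    have h4 : (2 : ℝ) ^ 4 * (n : ℝ) ^ 3 ≤ (n : ℝ) ^ 4 * (n : ℝ) ^ 3 := by gcongr
    have h5 : (n : ℝ) ^ 4 * (n : ℝ) ^ 3 = (n : ℝ) ^ 7 := by ring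
    linarith
  have h2 : (7 / 8 : ℝ) ^ T ≤ 1 / (n : ℝ) ^ (7 * (Λ + 1) + c) := by
    have h3 : (7 / 8 : ℝ) ≤ Real.exp (-(1 / 8)) := by
      have := Real.add_one_le_exp (-(1 / 8) : ℝ)
      linarith
    calc (7 / 8 : ℝ) ^ T ≤ Real.exp (-(1 / 8)) ^ T := by gcongr
      _ = Real.exp (-(T / 8)) := by
        rw [← Real.exp_nat_mul]
        ring_nf
      _ ≤ Real.exp (-((7 * (Λ + 1) + c : ℕ) * Real.log n)) := by
        refine Real.exp_le_exp.2 ?_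
        push_cast
        linarith
      _ = 1 / (n : ℝ) ^ (7 * (Λ + 1) + c) := by
        rw [Real.exp_neg, Real.exp_nat_mul, Real.exp_log hn0, one_div]
  calc (7 / 8 : ℝ) ^ T * (8 * (n : ℝ) ^ 3 + 1) ^ (Λ + 1)
      ≤ 1 / (n : ℝ) ^ (7 * (Λ + 1) + c) * ((n : ℝ) ^ 7) ^ (Λ + 1) := by gcongr
    _ = 1 / (n : ℝ) ^ c := by
      rw [← pow_mul, pow_add]
      field_simp

/-- The covering process ends within `T` phases with high probability. -/
theorem coinMeasure_exists_lv_pos_le {N : ℕ} (hN : Γ.numVertices ≤ N) (T : ℕ) :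
    alg.coinMeasure N V
      {ω | ∃ c, 0 < lv (edgeIds Γ) (uncovered (edgeIds Γ) (ranks Γ ω) T) c} ≤
      ENNReal.ofReal ((7 / 8) ^ T * (8 * (Γ.numVertices : ℝ) ^ 3 + 1) ^
        (Nat.log 2 (2 * Γ.maxDegree) + 1)) := by
  classical
  refine drawMeasure_exists_lv_pos_le (s := alg.sides N) (τ := fun i => 6 * i + 2)
    Γ.ident_injective (fun c => exists_ident_of_mem_verts) ?_ (by positivity) ?_
    (fun U hU c => lv_le_log_maxDegree hU c) (fun i j hij => by simp only; omega) T
  · change 10 * Γ.numVertices ^ 2 ≤ 10 * N ^ 2 + 1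
    have := Nat.pow_le_pow_left hN 2
    omega
  · rw [card_edgeIds]
    have h1 : (Γ.numEdges : ℝ) ≤ (Γ.numVertices : ℝ) ^ 2 := by exact_mod_cast numEdges_le
    calc (Fintype.card V : ℝ) * Γ.numEdges ≤ Γ.numVertices * (Γ.numVertices : ℝ) ^ 2 :=
          mul_le_mul_of_nonneg_left h1 (Nat.cast_nonneg _)
      _ = (Γ.numVertices : ℝ) ^ 3 := by ring

theorem coinMeasure_haltsWithin_ge (c : ℕ) {N : ℕ} (hN : Γ.numVertices ≤ N) :
    ENNReal.ofReal (1 - 1 / (Γ.numVertices : ℝ) ^ c) ≤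
      alg.coinMeasure N V
        {ω | ∃ t : ℕ, (t : ℝ) ≤ 6 * (8 * (42 + 2 * c) + 2) *
          max 1 (Real.log (Γ.numVertices : ℝ) * Real.log (Γ.maxDegree : ℝ)) ∧
          alg.HaltsWithin Γ N ω t} := by
  -- for a single vertex, the claimed probability is zero
  rcases (show 1 ≤ Γ.numVertices from numVertices_pos).eq_or_lt with h1 | hn
  · simp [← h1]
  set Λ := Nat.log 2 (2 * Γ.maxDegree) with hΛ
  set X := max 1 (Real.log (Γ.numVertices : ℝ) * Real.log (Γ.maxDegree : ℝ)) with hX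
  set T := ⌈8 * ((7 * (Λ + 1) + c) * Real.log Γ.numVertices)⌉₊ with hT
  have hlogn : 0 ≤ Real.log Γ.numVertices := Real.log_natCast_nonneg _
  have htail := tail_le hn c Λ (Nat.le_ceil _)
  rw [← hT] at htail
  have hbad := (coinMeasure_exists_lv_pos_le hN T).trans (ENNReal.ofReal_le_ofReal htail)
  set bad : Set (alg.Coins N V) :=
    {ω | ∃ c, 0 < lv (edgeIds Γ) (uncovered (edgeIds Γ) (ranks Γ ω) T) c} with hbad'
  have htime : ((6 * (T + 1) : ℕ) : ℝ) ≤ 6 * (8 * (42 + 2 * c) + 2) * X := by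
    obtain ⟨h1, h2⟩ := log_mul_levels_le hn
    rw [← hΛ, ← hX] at h1
    rw [← hX] at h2
    have h3 : (T : ℝ) < 8 * ((7 * (Λ + 1) + c) * Real.log Γ.numVertices) + 1 :=
      Nat.ceil_lt_add_one (by positivity)
    have h4 : (c : ℝ) * Real.log Γ.numVertices ≤ c * (2 * X) := by gcongr
    have h5 : (1 : ℝ) ≤ X := le_max_left _ _
    push_cast
    linarith
  have hsub : badᶜ ⊆ {ω | ∃ t : ℕ, (t : ℝ) ≤ 6 * (8 * (42 + 2 * c) + 2) * X ∧
      alg.HaltsWithin Γ N ω t} := by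
    intro ω hω
    refine ⟨_, htime, haltsWithin_of_forall_lv_eq_zero fun d => ?_⟩
    by_contra hne
    exact hω ⟨d, Nat.pos_of_ne_zero hne⟩
  have : IsProbabilityMeasure (alg.coinMeasure N V) :=
    inferInstanceAs (IsProbabilityMeasure (drawMeasure V (alg.sides N)))
  refine le_trans ?_ (measure_mono hsub)
  rw [ENNReal.ofReal_sub _ (by positivity), ENNReal.ofReal_one, tsub_le_iff_right]
  calc (1 : ENNReal) = alg.coinMeasure N V (badᶜ ∪ bad) := by
        rw [Set.compl_union_self, measure_univ]
    _ ≤ alg.coinMeasure N V badᶜ + alg.coinMeasure N V bad := measure_union_le _ _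
    _ ≤ _ := by gcongr

end Rounds

end TwoSpanner

theorem mainTheorem9 :
    ∃ (A : LocalAlg) (C : ℝ),
      -- the approximation ratio is guaranteed, whatever the random draws are
      (∀ (V : Type) [Fintype V] (Γ : Network V) (N : ℕ), Γ.numVertices ≤ N →
        ∀ ω : A.Coins N V, ∃ t : ℕ,
          A.HaltsWithin Γ N ω t ∧ A.OutputsIncidentEdges Γ N ω t ∧
          IsApproxMinDirectedSpanner Γ.graph 2
            (C * max 1 (Real.log ((Γ.numEdges : ℝ) / (Γ.numVertices : ℝ))))
            (A.outputEdges Γ N ω t)) ∧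
      -- the number of rounds, with high probability
      (∀ c : ℕ, ∃ C' : ℝ,
        ∀ (V : Type) [Fintype V] (Γ : Network V) (N : ℕ), Γ.numVertices ≤ N →
          ENNReal.ofReal (1 - 1 / (Γ.numVertices : ℝ) ^ c) ≤
            A.coinMeasure N V
              {ω | ∃ t : ℕ,
                (t : ℝ) ≤ C' * max 1 (Real.log (Γ.numVertices : ℝ) * Real.log (Γ.maxDegree : ℝ)) ∧
                A.HaltsWithin Γ N ω t}) := by
  refine ⟨TwoSpanner.alg, 273, fun V _ Γ N _ ω => ?_, fun c =>
    ⟨6 * (8 * (42 + 2 * c) + 2), fun V _ Γ N hN => TwoSpanner.coinMeasure_haltsWithin_ge c hN⟩⟩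
  obtain ⟨T, hT⟩ := TwoSpanner.exists_forall_lv_eq_zero (E := TwoSpanner.edgeIds Γ)
    (r := TwoSpanner.ranks Γ ω)
  exact ⟨6 * (T + 1), TwoSpanner.haltsWithin_of_forall_lv_eq_zero hT,
    TwoSpanner.outputsIncidentEdges_of_forall_lv_eq_zero hT,
    TwoSpanner.isApproxMinDirectedSpanner_preimage (fun c => TwoSpanner.lv_eq_zero_succ (hT c))
      fun _ => TwoSpanner.mem_outputEdges_iff hT⟩
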